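/- Let $\mu:\mathbb{C}^2\to\mathbb{R}^2_{\ge 0}$, $\mu(z_1,z_2)=(\pi|z_1|^2,\pi|z_2|^2)$, and let $\Omega\subset\mathbb{R}^2_{\ge 0}$ be a compact set containing a neighbourhood of the origin in $\mathbb{R}^2_{\ge0}$, whose boundary relative to $\mathbb{R}^2_{\ge 0}$ (the profile curve) is smooth up to and including its points on the axes, is transverse to the rays from the origin, and meets each ray of $\mathbb{R}^2_{\ge0}$ from the origin exactly once. Let $X_\Omega=\mu^{-1}(\Omega)\subset\mathbb{C}^2=\mathbb{R}^4$ be the corresponding smooth star-shaped toric domain, $Y=\partial X_\Omega$, let $\lambda=\frac12\sum_{i=1}^2 (x_i\,dy_i-y_i\,dx_i)$, and let $\xi=TY\cap\ker\lambda$ be the contact structure on $Y$. For a global symplectic trivialization $\tau$ of $(\xi,d\lambda)$, a point $y\in Y$ and $T\ge 0$, let $\rho(y,T,\tau)\in\mathbb{R}$ be the rotation number (measured in full turns) of the element of $\widetilde{\mathrm{Sp}}(2)$ represented by the path, for $t\in[0,T]$, of the linearized time-$t$ Reeb flows of $\lambda|_Y$ on $\xi$ starting at $y$, written in $\tau$;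 here the rotation number of an element of $\widetilde{\mathrm{Sp}}(2)$ is the translation number of the induced lift to $\mathbb{R}$ of its action on the circle of directions $\mathbb{R}/\mathbb{Z}$. Then global symplectic trivializations of $\xi$ exist, for every $y\in Y$ the limit $$\mathrm{rot}(y)=\lim_{T\to+\infty}\frac{\rho(y,T,\tau)}{T}$$ exists and does not depend on $\tau$, the function $\mathrm{rot}$ is integrable with respect to $\lambda\wedge d\lambda$, and the Ruelle invariant of $X_\Omega$ is $$\mathrm{Ru}(X_\Omega):=\int_{Y}\mathrm{rot}(y)\,\lambda\wedge d\lambda=a(\Omega)+b(\Omega),$$ where $Y$ is oriented so that $\lambda\wedge d\lambda>0$, and $a(\Omega)=\max\{s:(s,0)\in\Omega\}$ and $b(\Omega)=\max\{s:(0,s)\in\Omega\}$ are the $w_1$- and $w_2$-intercepts of $\Omega$. No assumption is made on the sign of the slopes of the profile curve. -/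

import Mathlib

open Set Filter Topology MeasureTheory
open scoped ContDiff

noncomputable section

namespace ToricRuelle

/-! ### Toric domains -/

/-- The closed quadrant of pairs of non-negative reals. -/
def quadrant : Set (ℝ × ℝ) := {w | 0 ≤ w.1 ∧ 0 ≤ w.2}

/-- The moment map `(z₁, z₂) ↦ (π|z₁|², π|z₂|²)`. -/
def momentMap (z : ℂ × ℂ) : ℝ × ℝ := (Real.pi * ‖z.1‖ ^ 2, Real.pi * ‖z.2‖ ^ 2)

/-- The toric domain `X_Ω = μ⁻¹(Ω)`. -/
def toricDomain (Ω : Set (ℝ × ℝ)) : Set (ℂ × ℂ) := momentMap ⁻¹' Ω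

/-- The profile curve: the boundary of a closed set `Ω` relative to the quadrant. -/
def profileCurve (Ω : Set (ℝ × ℝ)) : Set (ℝ × ℝ) := {p | p ∈ Ω ∧ Ω ∉ 𝓝[quadrant] p}

/-- `Ω` is the moment image of a smooth star-shaped toric domain: it is a compact subset of the
quadrant, contains a neighbourhood of the origin, its boundary (relative to the quadrant, up to and
including the points on the axes) is smooth and transverse to the rays from the origin, and every
ray of the quadrant meets this boundary exactly once. -/
structure IsSmoothStarShaped (Ω : Set (ℝ × ℝ)) : Prop where
  subset_quadrant : Ω ⊆ quadrant
  isCompact : IsCompact Ω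
  nhds_origin : Ω ∈ 𝓝[quadrant] (0 : ℝ × ℝ)
  smooth_transverse : ∀ p ∈ profileCurve Ω, ∃ f : ℝ × ℝ → ℝ, ContDiff ℝ ∞ f ∧ f p = 0 ∧
    (∀ᶠ w in 𝓝[quadrant] p, (w ∈ Ω ↔ f w ≤ 0)) ∧ fderiv ℝ f p p ≠ 0
  meets_ray_once : ∀ u ∈ quadrant, u ≠ 0 → ∃! s : ℝ, 0 < s ∧ s • u ∈ profileCurve Ω

/-- The `w₁`-intercept `a(Ω)`. -/
def interceptOne (Ω : Set (ℝ × ℝ)) : ℝ := sSup {s : ℝ | (s, 0) ∈ Ω}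

/-- The `w₂`-intercept `b(Ω)`. -/
def interceptTwo (Ω : Set (ℝ × ℝ)) : ℝ := sSup {s : ℝ | (0, s) ∈ Ω}

/-! ### The standard contact form on a hypersurface, and its Reeb flow -/

/-- `λ = ½ ∑ (xᵢ dyᵢ - yᵢ dxᵢ)` at the point `z`, applied to `v`. -/
def stdLambda (z v : ℂ × ℂ) : ℝ :=
  (z.1.re * v.1.im - z.1.im * v.1.re + (z.2.re * v.2.im - z.2.im * v.2.re)) / 2

/-- `ω = dλ = ∑ dxᵢ ∧ dyᵢ` applied to `u, v`. -/
def stdOmega (u v : ℂ × ℂ) : ℝ :=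
  u.1.re * v.1.im - u.1.im * v.1.re + (u.2.re * v.2.im - u.2.im * v.2.re)

/-- The 3-form `λ ∧ dλ` at the point `z`, applied to `u, v, w`. -/
def contactForm3 (z u v w : ℂ × ℂ) : ℝ :=
  stdLambda z u * stdOmega v w - stdLambda z v * stdOmega u w + stdLambda z w * stdOmega u v

/-- The tangent space `T_y Y` of a hypersurface `Y`, as a set of vectors. -/
def tangentSet (Y : Set (ℂ × ℂ)) (y : ℂ × ℂ) : Set (ℂ × ℂ) := tangentConeAt ℝ Y y

/-- The contact plane `ξ_y = T_y Y ∩ ker λ_y`. -/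
def contactPlane (Y : Set (ℂ × ℂ)) (y : ℂ × ℂ) : Set (ℂ × ℂ) :=
  {v | v ∈ tangentSet Y y ∧ stdLambda y v = 0}

/-- `R` is the Reeb vector of `λ|_Y` at `y`. -/
def IsReebVector (Y : Set (ℂ × ℂ)) (y R : ℂ × ℂ) : Prop :=
  R ∈ tangentSet Y y ∧ stdLambda y R = 1 ∧ ∀ v ∈ tangentSet Y y, stdOmega R v = 0

/-- `φ t` restricted to `Y` is the time-`t` Reeb flow of `λ|_Y` (values off `Y` are irrelevant). -/
def IsReebFlow (Y : Set (ℂ × ℂ)) (φ : ℝ → ℂ × ℂ → ℂ × ℂ) : Prop :=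
  ∀ y ∈ Y, φ 0 y = y ∧ ∀ t, φ t y ∈ Y ∧
    ∃ R, IsReebVector Y (φ t y) R ∧ HasDerivAt (fun s => φ s y) R t

/-- A global symplectic trivialization of `(ξ, dλ)` over `Y`, given by the frame `(e₁, e₂)` that it
sends to the standard basis of `ℝ²`. -/
structure IsSymplecticFrame (Y : Set (ℂ × ℂ)) (e₁ e₂ : ℂ × ℂ → ℂ × ℂ) : Prop where
  continuousOn_fst : ContinuousOn e₁ Y
  continuousOn_snd : ContinuousOn e₂ Y
  mem_fst : ∀ y ∈ Y, e₁ y ∈ contactPlane Y y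
  mem_snd : ∀ y ∈ Y, e₂ y ∈ contactPlane Y y
  omega_eq_one : ∀ y ∈ Y, stdOmega (e₁ y) (e₂ y) = 1

/-- The linearized Reeb flow `Φ_{y,t}` in the trivialization: the matrix of
`d(φ t) : ξ_y → ξ_{φ t y}` in the frame. A vector `v` of a contact plane has the coordinates
`ω(v, e₂), ω(e₁, v)`. The derivative of `φ t` within `Y` is only applied to vectors tangent
to `Y`, on which it is uniquely determined. -/
def linearizedFlow (Y : Set (ℂ × ℂ)) (φ : ℝ → ℂ × ℂ → ℂ × ℂ) (e₁ e₂ : ℂ × ℂ → ℂ × ℂ)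
    (y : ℂ × ℂ) (t : ℝ) : Matrix (Fin 2) (Fin 2) ℝ :=
  let D := fderivWithin ℝ (φ t) Y y
  let y' := φ t y
  !![stdOmega (D (e₁ y)) (e₂ y'), stdOmega (D (e₂ y)) (e₂ y');
     stdOmega (e₁ y') (D (e₁ y)), stdOmega (e₁ y') (D (e₂ y))]

/-! ### Rotation numbers -/

/-- The unit vector of `ℝ²` at angle `2πs`. -/
def unitVec (s : ℝ) : Fin 2 → ℝ := ![Real.cos (2 * Real.pi * s), Real.sin (2 * Real.pi * s)]

/-- For a path `(Φ t)`, `t ∈ [0, T]`, of matrices with `Φ 0 = 1`: `f` is the lift to `ℝ` of the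
action of `Φ T` on the circle of directions `ℝ/ℤ` that the path determines, i.e. `f s` is the end
point of the continuous angle (in turns), starting from `s`, of the vectors `Φ t (unitVec s)`. -/
def IsDirectionLift (Φ : ℝ → Matrix (Fin 2) (Fin 2) ℝ) (T : ℝ) (f : CircleDeg1Lift) : Prop :=
  ∀ s : ℝ, ∃ θ : ℝ → ℝ, ContinuousOn θ (Icc 0 T) ∧ θ 0 = s ∧ θ T = f s ∧
    ∀ t ∈ Icc 0 T, ∃ r : ℝ, 0 < r ∧ (Φ t).mulVec (unitVec s) = r • unitVec (θ t)

/-- `ρ` is the rotation number of the element of the universal cover of `Sp(2)` represented by the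
path `(Φ t)`, `t ∈ [0, T]`. -/
def IsRotationNumber (Φ : ℝ → Matrix (Fin 2) (Fin 2) ℝ) (T ρ : ℝ) : Prop :=
  ∃ f : CircleDeg1Lift, IsDirectionLift Φ T f ∧ f.translationNumber = ρ

/-- The rotation numbers `ρ(T)` of `Φ` on `[0, T]` exist for all `T ≥ 0`, and `ρ(T)/T → r` as
`T → ∞`. -/
def HasMeanRotation (Φ : ℝ → Matrix (Fin 2) (Fin 2) ℝ) (r : ℝ) : Prop :=
  ∃ ρ : ℝ → ℝ, (∀ T, 0 ≤ T → IsRotationNumber Φ T (ρ T)) ∧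
    Tendsto (fun T => ρ T / T) atTop (𝓝 r)

/-- `rot` is, on `Y`, the mean rotation function of the Reeb flow: the Reeb flow and global
trivializations exist, and at every point of `Y` the limit defining the mean rotation exists and is
`rot y`, whatever the trivialization. -/
def IsRotationFunction (Y : Set (ℂ × ℂ)) (rot : ℂ × ℂ → ℝ) : Prop :=
  (∃ φ, IsReebFlow Y φ) ∧ (∃ e₁ e₂, IsSymplecticFrame Y e₁ e₂) ∧
    ∀ φ e₁ e₂, IsReebFlow Y φ → IsSymplecticFrame Y e₁ e₂ →
      ∀ y ∈ Y, HasMeanRotation (linearizedFlow Y φ e₁ e₂ y) (rot y)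

/-! ### The contact volume and the Ruelle invariant -/

/-- `m` is the measure on the hypersurface `Y` of the volume form `λ ∧ dλ` (with `Y` oriented so
that this form is positive): it is carried by `Y` and is given in every smooth local
parametrization `ψ` of `Y` by the density `|(λ ∧ dλ)(∂₁ψ, ∂₂ψ, ∂₃ψ)|`. -/
def IsContactVolume (Y : Set (ℂ × ℂ)) (m : Measure (ℂ × ℂ)) : Prop :=
  m Yᶜ = 0 ∧
  ∀ (U : Set (Fin 3 → ℝ)) (ψ : (Fin 3 → ℝ) → ℂ × ℂ), IsOpen U → ContDiffOn ℝ ∞ ψ U →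
    InjOn ψ U → (∀ u ∈ U, Function.Injective (fderiv ℝ ψ u)) → MapsTo ψ U Y →
    ∀ A ⊆ U, MeasurableSet A →
      m (ψ '' A) = ∫⁻ u in A, ENNReal.ofReal |contactForm3 (ψ u)
        (fderiv ℝ ψ u (Pi.single 0 1)) (fderiv ℝ ψ u (Pi.single 1 1))
        (fderiv ℝ ψ u (Pi.single 2 1))|

/-- The Ruelle invariant `Ru(Y, λ|_Y) = ∫_Y rot λ ∧ dλ` is well defined and equals `c`. -/
def HasRuelleInvariant (Y : Set (ℂ × ℂ)) (c : ℝ) : Prop :=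
  ∃ rot : ℂ × ℂ → ℝ, IsRotationFunction Y rot ∧ (∃ m, IsContactVolume Y m) ∧
    ∀ m, IsContactVolume Y m → Integrable rot m ∧ ∫ y, rot y ∂m = c

end ToricRuelle

end

noncomputable section

namespace ToricRuelle

/-! ### Continuous logarithms and angles -/

/-! Write $w=\mu(z)$ and let $q(t)$ be the inverse of the radius of the profile curve along the ray
through $(1-t,t)$. Then $Y=\{H=1\}$ for the toric Hamiltonian $H=(w_1+w_2)\,q(w_2/(w_1+w_2))$
(`exists_level_eq`). Since $H$ is homogeneous of degree two in $z$, its Hamiltonian field is the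
Reeb field on $Y$; the flow turns $z_1,z_2$ at the constant rates $\partial H/\partial w_1,\partial
H/\partial w_2$ (`freqOne`, `freqTwo`).

The determinant $z_1v_2-z_2v_1$ is a global complex coordinate on $\xi$. In it the linearized flow
is a rotation at the sum of the two rates composed with a shear that fixes one direction, so a
vector in that direction turns at exactly this sum (`fderivWithin_reebFlow`, `exists_shear_fixed`).
Any other frame changes the angle by a bounded amount, because torus orbits contract in $Y$
(`exists_bounded_log`). Hence rot is `freqOne + freqTwo` at `ratio y`, whatever the frame
(`hasMeanRotation_linearizedFlow`).

For the integral, $\lambda\wedge d\lambda$ is twice the radial push-forward of Lebesgue measure on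
the cone over $Y$ (`isContactVolume_coneMeasure`, `IsContactVolume.eq`), and $\mu$ carries Lebesgue
measure to Lebesgue measure on the quadrant. In radial coordinates there remains $\int_0^1
(2q+(1-2t)q')/q^2\,dt=[(2t-1)/q]_0^1=1/q(0)+1/q(1)=a+b$ (`integral_freq_div`). Only $q>0$ and
smoothness enter, hence no condition on slopes. -/

theorem exists_continuous_log {X : Type*} [TopologicalSpace X] [LocallyPathConnectedSpace X]
    [SimplyConnectedSpace X] {g : X → ℂ} (hg : Continuous g) (h0 : ∀ x, g x ≠ 0) :
    ∃ L : X → ℂ, Continuous L ∧ ∀ x, Complex.exp (L x) = g x := by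
  obtain ⟨x₀⟩ : Nonempty X := inferInstance
  obtain ⟨F, ⟨-, hF⟩, -⟩ := Complex.isCoveringMapOn_exp.existsUnique_continuousMap_lifts
    ⟨g, hg⟩ (a₀ := x₀) (Complex.exp_log (h0 x₀)) (fun x => h0 x)
  exact ⟨F, F.continuous, fun x => congrFun hF x⟩

theorem isDiscrete_range_intCast : IsDiscrete (range ((↑) : ℤ → ℝ)) :=
  (Int.isClosedEmbedding_coe_real.isEmbedding.isInducing.isDiscrete_range)

theorem eq_of_continuousOn_of_int {X : Type*} [TopologicalSpace X] {s : Set X}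
    (hs : IsPreconnected s) {f : X → ℝ} (hf : ContinuousOn f s)
    (hfz : ∀ x ∈ s, ∃ n : ℤ, f x = n) {x y : X} (hx : x ∈ s) (hy : y ∈ s) : f x = f y := by
  exact hs.constant_of_mapsTo isDiscrete_range_intCast hf (fun z hz => (hfz z hz).imp fun _ h => h.symm) hx hy

/-- Two continuous logarithms of one function differ by a constant. All normalizations and periods
of logarithms below are obtained by evaluating this constant at a convenient point. -/
theorem eq_of_exp_eq_one {X : Type*} [TopologicalSpace X] [PreconnectedSpace X] {h : X → ℂ}
    (hc : Continuous h) (h1 : ∀ x, Complex.exp (h x) = 1) (x y : X) : h x = h y := by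
  have key : ∀ x, ∃ n : ℤ, h x = n * (2 * Real.pi * Complex.I) := fun x =>
    Complex.exp_eq_one_iff.1 (h1 x)
  have hpi : (2 * Real.pi : ℝ) ≠ 0 := by positivity
  have him : (fun x => (h x).im / (2 * Real.pi)) x = (fun x => (h x).im / (2 * Real.pi)) y := by
    have hc' : Continuous fun x => (h x).im / (2 * Real.pi) := by fun_prop
    refine eq_of_continuousOn_of_int isPreconnected_univ hc'.continuousOn
      (fun z _ => ?_) (mem_univ _) (mem_univ _)
    obtain ⟨n, hn⟩ := key z
    refine ⟨n, ?_⟩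
    rw [hn]
    simp
  obtain ⟨n, hn⟩ := key x
  obtain ⟨m, hm⟩ := key y
  simp only [hn, hm] at him ⊢
  simp at him
  rw [him]

/-- A vector of `ℝ²` as a complex number. -/
def vecToComplex (u : Fin 2 → ℝ) : ℂ := ⟨u 0, u 1⟩

theorem vecToComplex_injective : Function.Injective vecToComplex := by
  intro u v h
  have h' := Complex.ext_iff.1 h
  ext i
  fin_cases i
  · exact h'.1
  · exact h'.2

theorem vecToComplex_smul (a : ℝ) (u : Fin 2 → ℝ) :
    vecToComplex (a • u) = a * vecToComplex u := by
  apply Complex.ext <;> simp [vecToComplex]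

theorem vecToComplex_eq_zero {u : Fin 2 → ℝ} (h : vecToComplex u = 0) : u = 0 :=
  vecToComplex_injective (h.trans (by apply Complex.ext <;> simp [vecToComplex]))

theorem continuous_vecToComplex : Continuous vecToComplex := by
  have : vecToComplex = fun u => (u 0 : ℂ) + (u 1 : ℂ) * Complex.I := by
    funext u
    apply Complex.ext <;> simp [vecToComplex]
  rw [this]
  fun_prop

theorem vecToComplex_unitVec (s : ℝ) :
    vecToComplex (unitVec s) = Complex.exp ((2 * Real.pi * s : ℝ) * Complex.I) := by
  apply Complex.ext
  · rw [Complex.exp_ofReal_mul_I_re]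
    rfl
  · rw [Complex.exp_ofReal_mul_I_im]
    rfl

theorem unitVec_ne_zero (s : ℝ) : unitVec s ≠ 0 := by
  intro h
  have := vecToComplex_unitVec s
  rw [h] at this
  exact Complex.exp_ne_zero _ (this.symm.trans (by apply Complex.ext <;> simp [vecToComplex]))

theorem continuous_unitVec : Continuous unitVec := by
  unfold unitVec
  fun_prop

theorem unitVec_add_int (s : ℝ) (n : ℤ) : unitVec (s + n) = unitVec s := by
  apply vecToComplex_injective
  rw [vecToComplex_unitVec, vecToComplex_unitVec, Complex.exp_eq_exp_iff_exists_int]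
  exact ⟨n, by push_cast; ring⟩

/-- A nonzero vector whose complex logarithm is known. -/
theorem eq_smul_unitVec_of_exp {u : Fin 2 → ℝ} {l : ℂ} (h : vecToComplex u = Complex.exp l) :
    u = Real.exp l.re • unitVec (l.im / (2 * Real.pi)) := by
  apply vecToComplex_injective
  have hpi : (2 * Real.pi : ℝ) ≠ 0 := by positivity
  rw [vecToComplex_smul, vecToComplex_unitVec, h, mul_div_cancel₀ _ hpi, Complex.ofReal_exp,
    ← Complex.exp_add, Complex.re_add_im]

theorem exists_int_of_smul_unitVec_eq {a b x y : ℝ} (ha : 0 < a) (hb : 0 < b)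
    (h : a • unitVec x = b • unitVec y) : ∃ n : ℤ, x = y + n := by
  have h1 := congrArg vecToComplex h
  rw [vecToComplex_smul, vecToComplex_smul, vecToComplex_unitVec, vecToComplex_unitVec] at h1
  have h2 := congrArg norm h1
  rw [norm_mul, norm_mul, Complex.norm_exp_ofReal_mul_I, Complex.norm_exp_ofReal_mul_I,
    Complex.norm_real, Complex.norm_real, Real.norm_of_nonneg ha.le, Real.norm_of_nonneg hb.le,
    mul_one, mul_one] at h2
  subst h2
  have h3 := mul_left_cancel₀ (by exact_mod_cast ha.ne') h1
  obtain ⟨n, hn⟩ := Complex.exp_eq_exp_iff_exists_int.1 h3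
  refine ⟨n, ?_⟩
  have h4 := congrArg Complex.im hn
  simp at h4
  have hpi := Real.pi_pos
  nlinarith [hpi]

/-! ### Mean rotation from the angle of a single vector -/

/-- A continuous path of invertible matrices starting at the identity acts on the line covering
the circle of directions: `Θ t` is the lift of the action of `Φ t`. -/
theorem exists_continuous_directionLift {Φ : ℝ → Matrix (Fin 2) (Fin 2) ℝ}
    (hc : ContinuousOn Φ (Ici 0)) (h0 : Φ 0 = 1) (hdet : ∀ t, 0 ≤ t → (Φ t).det ≠ 0) :
    ∃ Θ : ℝ → CircleDeg1Lift, (∀ s, Continuous fun t => Θ t s) ∧ (∀ s, Θ 0 s = s) ∧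
      ∀ t, 0 ≤ t → ∀ s, ∃ a : ℝ, 0 < a ∧ (Φ t).mulVec (unitVec s) = a • unitVec (Θ t s) := by
  -- Freezing the path at negative times makes the parameter space the whole plane, which is simply
  -- connected.
  set Ψ : ℝ → Matrix (Fin 2) (Fin 2) ℝ := fun t => Φ (max 0 t) with hΨ
  have hΨc : Continuous Ψ := hc.comp_continuous (by fun_prop) (fun t => mem_Ici.2 (le_max_left _ _))
  have hΨ0 : Ψ 0 = 1 := by simp [hΨ, h0]
  have hinj : ∀ t, Function.Injective (Ψ t).mulVec := fun t => by
    rw [Matrix.mulVec_injective_iff_isUnit, Matrix.isUnit_iff_isUnit_det]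
    exact (hdet _ (le_max_left _ _)).isUnit
  set W : ℝ × ℝ → ℂ := fun p => vecToComplex ((Ψ p.1).mulVec (unitVec p.2)) with hW
  have hWc : Continuous W := continuous_vecToComplex.comp
    (Continuous.matrix_mulVec (hΨc.comp continuous_fst) (continuous_unitVec.comp continuous_snd))
  have hW0 : ∀ p, W p ≠ 0 := fun p h => unitVec_ne_zero p.2
    (hinj p.1 ((vecToComplex_eq_zero h).trans (Matrix.mulVec_zero _).symm))
  have hWs : ∀ s, W (0, s) = Complex.exp ((2 * Real.pi * s : ℝ) * Complex.I) := fun s => by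
    simp only [hW, hΨ0, Matrix.one_mulVec, vecToComplex_unitVec]
  obtain ⟨L₀, hL₀c, hL₀⟩ := exists_continuous_log hWc hW0
  -- Since `W (0, 0) = 1`, the subtracted constant is a period of `exp`; the normalization makes the
  -- angle at time 0 equal to `s` itself.
  set L : ℝ × ℝ → ℂ := fun p => L₀ p - L₀ (0, 0) with hL
  have hLc : Continuous L := by fun_prop
  have hLexp : ∀ p, Complex.exp (L p) = W p := fun p => by
    rw [hL, Complex.exp_sub, hL₀, hL₀, hWs]
    simp
  have hL0 : ∀ s, L (0, s) = (2 * Real.pi * s : ℝ) * Complex.I := fun s => by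
    have := eq_of_exp_eq_one (h := fun s : ℝ => L (0, s) - (2 * Real.pi * s : ℝ) * Complex.I)
      (by fun_prop) (fun s => by rw [Complex.exp_sub, hLexp, hWs, div_self (Complex.exp_ne_zero _)])
      s 0
    simp only [hL, sub_self, mul_zero, Complex.ofReal_zero, zero_mul] at this ⊢
    exact sub_eq_zero.1 this
  -- The increment under `s ↦ s + 1` is constant on the plane, so it can be computed at the origin.
  have hL1 : ∀ t s, L (t, s + 1) = L (t, s) + 2 * Real.pi * Complex.I := fun t s => by
    have := eq_of_exp_eq_one
      (h := fun p : ℝ × ℝ => L (p.1, p.2 + 1) - L p) (by fun_prop)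
      (fun p => by
        have h1 : W (p.1, p.2 + 1) = W p := by
          simp only [hW]
          rw [show p.2 + 1 = p.2 + (1 : ℤ) by simp, unitVec_add_int]
        rw [Complex.exp_sub, hLexp, hLexp, h1, div_self (hW0 _)]) (t, s) (0, 0)
    simp only [hL0] at this
    rw [sub_eq_iff_eq_add] at this
    rw [this]
    push_cast
    ring
  have hpi : (2 * Real.pi : ℝ) ≠ 0 := by positivity
  set θ : ℝ → ℝ → ℝ := fun t s => (L (t, s)).im / (2 * Real.pi) with hθ
  have hθ1 : ∀ t s, θ t (s + 1) = θ t s + 1 := fun t s => by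
    simp only [hθ, hL1]
    simp
    field_simp
  have hθn : ∀ t s (n : ℤ), θ t (s + n) = θ t s + n := fun t s n => by
    have hp : Function.Periodic (fun s => θ t s - s) 1 := fun s => by
      simp only [hθ1]
      ring
    have := hp.int_mul n s
    simp only [mul_one] at this
    linarith
  have hdir : ∀ t s, ∃ a : ℝ, 0 < a ∧ (Ψ t).mulVec (unitVec s) = a • unitVec (θ t s) :=
    fun t s => ⟨_, Real.exp_pos _, eq_smul_unitVec_of_exp (hLexp (t, s)).symm⟩
  -- Equal angles put both images on one ray. Invertibility then makes `s - s'` an integer, and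
  -- equivariance makes that integer zero.
  have hθinj : ∀ t, Function.Injective (θ t) := fun t s s' hss => by
    obtain ⟨a, ha, h1⟩ := hdir t s
    obtain ⟨b, hb, h2⟩ := hdir t s'
    rw [hss] at h1
    have h3 : (Ψ t).mulVec (b • unitVec s) = (Ψ t).mulVec (a • unitVec s') := by
      rw [Matrix.mulVec_smul, Matrix.mulVec_smul, h1, h2, smul_smul, smul_smul, mul_comm]
    obtain ⟨n, hn⟩ := exists_int_of_smul_unitVec_eq hb ha (hinj t h3)
    rw [hn, hθn] at hss
    rw [hn]
    linarith
  -- A continuous injection of the line is strictly monotone or antitone; the unit increment over a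
  -- period excludes the second.
  have hmono : ∀ t, Monotone (θ t) := fun t => by
    have hct : Continuous (θ t) := by
      simp only [hθ]
      fun_prop
    rcases hct.strictMono_of_inj (hθinj t) with h | h
    · exact h.monotone
    · have h1 := h (show (0 : ℝ) < 0 + 1 by norm_num)
      rw [hθ1] at h1
      linarith
  refine ⟨fun t => ⟨⟨θ t, hmono t⟩, hθ1 t⟩, fun s => ?_, fun s => ?_, fun t ht s => ?_⟩
  · change Continuous fun t => θ t s
    simp only [hθ]
    fun_prop
  · change θ 0 s = s
    simp only [hθ, hL0]
    simp
  · obtain ⟨a, ha, h⟩ := hdir t s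
    simp only [hΨ, max_eq_right ht] at h
    exact ⟨a, ha, h⟩

/-- The translation number is within 1 of `f 0`, and `f s` is trapped between the values of `f` at
two consecutive integers. The constant is crude; what matters is that it does not depend on `f`. -/
theorem dist_translationNumber_le (f : CircleDeg1Lift) (s : ℝ) :
    |f.translationNumber - f s| ≤ |s| + 3 := by
  have h0 := f.dist_map_zero_translationNumber_le
  rw [Real.dist_eq, abs_le] at h0
  have h1 : f (⌊s⌋ : ℝ) = f 0 + ⌊s⌋ := by
    have := f.map_add_int 0 ⌊s⌋
    simpa using this
  have h2 : f (⌊s⌋ : ℝ) ≤ f s := f.monotone (Int.floor_le s)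
  have h3 : f s ≤ f ((⌊s⌋ : ℝ) + 1) := f.monotone (Int.lt_floor_add_one s).le
  rw [f.map_add_one] at h3
  have h4 := Int.floor_le s
  have h5 := Int.lt_floor_add_one s
  rw [abs_le]
  constructor <;> [linarith [le_abs_self s, neg_abs_le s]; linarith [le_abs_self s, neg_abs_le s]]

/-- The mean rotation can be read off from the angle of a single vector. -/
theorem hasMeanRotation_of_angle {Φ : ℝ → Matrix (Fin 2) (Fin 2) ℝ} {r : ℝ}
    (hc : ContinuousOn Φ (Ici 0)) (h0 : Φ 0 = 1) (hdet : ∀ t, 0 ≤ t → (Φ t).det ≠ 0)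
    {u : Fin 2 → ℝ} {θ : ℝ → ℝ} (hθ : ContinuousOn θ (Ici 0))
    (hu : ∀ t, 0 ≤ t → ∃ a : ℝ, 0 < a ∧ (Φ t).mulVec u = a • unitVec (θ t))
    (hlim : Tendsto (fun T => θ T / T) atTop (𝓝 r)) : HasMeanRotation Φ r := by
  obtain ⟨Θ, hΘc, hΘ0, hΘ⟩ := exists_continuous_directionLift hc h0 hdet
  obtain ⟨a₀, ha₀, hu₀⟩ := hu 0 le_rfl
  rw [h0, Matrix.one_mulVec] at hu₀
  -- Both sides are continuous angles of the same moving vector, so they differ by an integer, which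
  -- is zero at time 0.
  have hangle : ∀ t, 0 ≤ t → θ t = Θ t (θ 0) := fun t ht => by
    have := eq_of_continuousOn_of_int (f := fun t => θ t - Θ t (θ 0)) (s := Ici 0)
      isPreconnected_Ici (hθ.sub (hΘc _).continuousOn) (fun t ht => ?_) ht
      (mem_Ici.2 (le_refl (0 : ℝ)))
    · simp only [hΘ0, sub_self] at this
      linarith
    · obtain ⟨a, ha, h1⟩ := hu t ht
      obtain ⟨b, hb, h2⟩ := hΘ t ht (θ 0)
      rw [hu₀, Matrix.mulVec_smul, h2, smul_smul] at h1
      obtain ⟨n, hn⟩ := exists_int_of_smul_unitVec_eq ha (mul_pos ha₀ hb) h1.symm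
      exact ⟨n, by simp [hn]⟩
  refine ⟨fun T => (Θ T).translationNumber, fun T hT => ⟨Θ T, fun s => ⟨fun t => Θ t s,
    (hΘc s).continuousOn, hΘ0 s, rfl, fun t ht => hΘ t ht.1 s⟩, rfl⟩, ?_⟩
  -- The translation number of `Θ T` stays within `|θ 0| + 3` of `θ T`, uniformly in `T`.
  have hdiff : Tendsto (fun T => ((Θ T).translationNumber - θ T) / T) atTop (𝓝 0) := by
    refine squeeze_zero_norm' (a := fun T => (|θ 0| + 3) / T) ?_
      (tendsto_const_nhds.div_atTop tendsto_id)
    filter_upwards [eventually_gt_atTop 0] with T hT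
    rw [norm_div, Real.norm_of_nonneg hT.le, Real.norm_eq_abs, hangle T hT.le]
    exact div_le_div_of_nonneg_right (dist_translationNumber_le _ _) hT.le
  have := hdiff.add hlim
  rw [zero_add] at this
  refine this.congr fun T => ?_
  ring

/-! ### Toric Hamiltonians homogeneous of degree two -/

/-- The squared Euclidean norm of `ℂ²`. -/
def sqNorm (z : ℂ × ℂ) : ℝ := Complex.normSq z.1 + Complex.normSq z.2

/-- The slope coordinate `|z₂|² / (|z₁|² + |z₂|²)`. -/
def ratio (z : ℂ × ℂ) : ℝ := Complex.normSq z.2 / sqNorm z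

/-- The toric Hamiltonian `π|z|² q(|z₂|² / |z|²)`. -/
def ham (q : ℝ → ℝ) (z : ℂ × ℂ) : ℝ := Real.pi * sqNorm z * q (ratio z)

/-- The hypersurface `{ham = 1}`. -/
def level (q : ℝ → ℝ) : Set (ℂ × ℂ) := {z | ham q z = 1}

/-- The rotation frequency, in turns, of the first coordinate. -/
def freqOne (q : ℝ → ℝ) (t : ℝ) : ℝ := q t - t * deriv q t

/-- The rotation frequency, in turns, of the second coordinate. -/
def freqTwo (q : ℝ → ℝ) (t : ℝ) : ℝ := q t + (1 - t) * deriv q t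

/-- `v ↦ Re (conj z₁ v₁)`. -/
def radOne (z : ℂ × ℂ) : ℂ × ℂ →L[ℝ] ℝ :=
  z.1.re • (Complex.reCLM.comp (ContinuousLinearMap.fst ℝ ℂ ℂ)) +
    z.1.im • (Complex.imCLM.comp (ContinuousLinearMap.fst ℝ ℂ ℂ))

/-- `v ↦ Re (conj z₂ v₂)`. -/
def radTwo (z : ℂ × ℂ) : ℂ × ℂ →L[ℝ] ℝ :=
  z.2.re • (Complex.reCLM.comp (ContinuousLinearMap.snd ℝ ℂ ℂ)) +
    z.2.im • (Complex.imCLM.comp (ContinuousLinearMap.snd ℝ ℂ ℂ))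

/-- The derivative of `ratio`. -/
def dRatio (z : ℂ × ℂ) : ℂ × ℂ →L[ℝ] ℝ :=
  (2 / sqNorm z) • ((1 - ratio z) • radTwo z - ratio z • radOne z)

/-- The derivative of `ham q`. -/
def dHam (q : ℝ → ℝ) (z : ℂ × ℂ) : ℂ × ℂ →L[ℝ] ℝ :=
  (2 * Real.pi * freqOne q (ratio z)) • radOne z + (2 * Real.pi * freqTwo q (ratio z)) • radTwo z

@[simp] theorem radOne_apply (z v : ℂ × ℂ) :
    radOne z v = z.1.re * v.1.re + z.1.im * v.1.im := by simp [radOne]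

@[simp] theorem radTwo_apply (z v : ℂ × ℂ) :
    radTwo z v = z.2.re * v.2.re + z.2.im * v.2.im := by simp [radTwo]

theorem dHam_apply (q : ℝ → ℝ) (z v : ℂ × ℂ) :
    dHam q z v = 2 * Real.pi * freqOne q (ratio z) * (z.1.re * v.1.re + z.1.im * v.1.im) +
      2 * Real.pi * freqTwo q (ratio z) * (z.2.re * v.2.re + z.2.im * v.2.im) := by
  simp [dHam]

theorem sqNorm_pos {z : ℂ × ℂ} (hz : z ≠ 0) : 0 < sqNorm z := by
  rcases (Complex.normSq_nonneg z.1).lt_or_eq with h1 | h1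
  · exact add_pos_of_pos_of_nonneg h1 (Complex.normSq_nonneg _)
  · refine add_pos_of_nonneg_of_pos (Complex.normSq_nonneg _) (Complex.normSq_pos.2 fun h2 => hz ?_)
    exact Prod.ext (Complex.normSq_eq_zero.1 h1.symm) h2

theorem sqNorm_zero : sqNorm 0 = 0 := by simp [sqNorm]

theorem normSq_snd_eq {z : ℂ × ℂ} (hz : z ≠ 0) : Complex.normSq z.2 = ratio z * sqNorm z := by
  rw [ratio, div_mul_cancel₀ _ (sqNorm_pos hz).ne']

theorem normSq_fst_eq {z : ℂ × ℂ} (hz : z ≠ 0) : Complex.normSq z.1 = (1 - ratio z) * sqNorm z := by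
  rw [sub_mul, ← normSq_snd_eq hz, sqNorm]
  ring

theorem ratio_mem_Icc (z : ℂ × ℂ) : ratio z ∈ Icc (0 : ℝ) 1 := by
  have h1 := Complex.normSq_nonneg z.1
  have h2 := Complex.normSq_nonneg z.2
  have h3 : 0 ≤ sqNorm z := add_nonneg h1 h2
  exact ⟨div_nonneg h2 h3, div_le_one_of_le₀ (by rw [sqNorm]; linarith) h3⟩

theorem ham_pos {q : ℝ → ℝ} (hq : ∀ t, 0 < q t) {z : ℂ × ℂ} (hz : z ≠ 0) : 0 < ham q z :=
  mul_pos (mul_pos Real.pi_pos (sqNorm_pos hz)) (hq _)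

theorem ne_zero_of_mem_level {q : ℝ → ℝ} {z : ℂ × ℂ} (hz : z ∈ level q) : z ≠ 0 := by
  rintro rfl
  simp [level, ham, sqNorm_zero] at hz

theorem sqNorm_smul (c : ℝ) (z : ℂ × ℂ) : sqNorm (c • z) = c ^ 2 * sqNorm z := by
  simp [sqNorm, Complex.normSq_apply]
  ring

theorem ratio_smul {c : ℝ} (hc : c ≠ 0) (z : ℂ × ℂ) : ratio (c • z) = ratio z := by
  rw [ratio, ratio, sqNorm_smul]
  have : Complex.normSq (c • z).2 = c ^ 2 * Complex.normSq z.2 := by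
    simp [Complex.normSq_apply]
    ring
  rw [this, mul_div_mul_left _ _ (pow_ne_zero 2 hc)]

theorem ham_smul (q : ℝ → ℝ) {c : ℝ} (hc : c ≠ 0) (z : ℂ × ℂ) :
    ham q (c • z) = c ^ 2 * ham q z := by
  rw [ham, ham, sqNorm_smul, ratio_smul hc]
  ring

theorem continuous_sqNorm : Continuous sqNorm := by
  unfold sqNorm
  exact (Complex.continuous_normSq.comp continuous_fst).add
    (Complex.continuous_normSq.comp continuous_snd)

theorem contDiff_sqNorm : ContDiff ℝ ∞ sqNorm := by
  have : sqNorm = fun z => z.1.re * z.1.re + z.1.im * z.1.im + (z.2.re * z.2.re + z.2.im * z.2.im) := by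
    funext z
    simp [sqNorm, Complex.normSq_apply]
  rw [this]
  have h1 := Complex.reCLM.contDiff (n := ∞)
  have h2 := Complex.imCLM.contDiff (n := ∞)
  have a1 : ContDiff ℝ ∞ fun z : ℂ × ℂ => z.1.re := h1.comp contDiff_fst
  have a2 : ContDiff ℝ ∞ fun z : ℂ × ℂ => z.1.im := h2.comp contDiff_fst
  have a3 : ContDiff ℝ ∞ fun z : ℂ × ℂ => z.2.re := h1.comp contDiff_snd
  have a4 : ContDiff ℝ ∞ fun z : ℂ × ℂ => z.2.im := h2.comp contDiff_snd
  exact ((a1.mul a1).add (a2.mul a2)).add ((a3.mul a3).add (a4.mul a4))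

theorem contDiffAt_ratio {z : ℂ × ℂ} (hz : z ≠ 0) : ContDiffAt ℝ ∞ ratio z := by
  have h1 := Complex.reCLM.contDiff (n := ∞)
  have h2 := Complex.imCLM.contDiff (n := ∞)
  have a3 : ContDiff ℝ ∞ fun z : ℂ × ℂ => z.2.re := h1.comp contDiff_snd
  have a4 : ContDiff ℝ ∞ fun z : ℂ × ℂ => z.2.im := h2.comp contDiff_snd
  exact ((a3.mul a3).add (a4.mul a4)).contDiffAt.div contDiff_sqNorm.contDiffAt (sqNorm_pos hz).ne'

theorem contDiffAt_ham {q : ℝ → ℝ} (hq : ContDiff ℝ ∞ q) {z : ℂ × ℂ} (hz : z ≠ 0) :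
    ContDiffAt ℝ ∞ (ham q) z :=
  (contDiffAt_const.mul contDiff_sqNorm.contDiffAt).mul (hq.contDiffAt.comp z (contDiffAt_ratio hz))

theorem hasFDerivAt_normSq_fst (z : ℂ × ℂ) :
    HasFDerivAt (fun z : ℂ × ℂ => Complex.normSq z.1) ((2 : ℝ) • radOne z) z := by
  have h1 := (Complex.reCLM.comp (ContinuousLinearMap.fst ℝ ℂ ℂ)).hasFDerivAt (x := z)
  have h2 := (Complex.imCLM.comp (ContinuousLinearMap.fst ℝ ℂ ℂ)).hasFDerivAt (x := z)
  refine ((h1.mul h1).add (h2.mul h2)).congr_fderiv ?_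
  refine ContinuousLinearMap.ext fun v => ?_
  simp [radOne]
  ring

theorem hasFDerivAt_normSq_snd (z : ℂ × ℂ) :
    HasFDerivAt (fun z : ℂ × ℂ => Complex.normSq z.2) ((2 : ℝ) • radTwo z) z := by
  have h1 := (Complex.reCLM.comp (ContinuousLinearMap.snd ℝ ℂ ℂ)).hasFDerivAt (x := z)
  have h2 := (Complex.imCLM.comp (ContinuousLinearMap.snd ℝ ℂ ℂ)).hasFDerivAt (x := z)
  refine ((h1.mul h1).add (h2.mul h2)).congr_fderiv ?_
  refine ContinuousLinearMap.ext fun v => ?_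
  simp [radTwo]
  ring

theorem hasFDerivAt_sqNorm (z : ℂ × ℂ) :
    HasFDerivAt sqNorm ((2 : ℝ) • radOne z + (2 : ℝ) • radTwo z) z :=
  (hasFDerivAt_normSq_fst z).add (hasFDerivAt_normSq_snd z)

theorem hasFDerivAt_ratio {z : ℂ × ℂ} (hz : z ≠ 0) : HasFDerivAt ratio (dRatio z) z := by
  have hS := (sqNorm_pos hz).ne'
  refine ((hasFDerivAt_normSq_snd z).mul
    ((hasDerivAt_inv hS).comp_hasFDerivAt z (hasFDerivAt_sqNorm z))).congr_fderiv ?_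
  refine ContinuousLinearMap.ext fun v => ?_
  simp only [dRatio, smul_apply, sub_apply,
    add_apply, smul_eq_mul, Function.comp_apply]
  rw [normSq_snd_eq hz]
  field_simp
  ring

theorem hasFDerivAt_ham {q : ℝ → ℝ} (hq : ContDiff ℝ ∞ q) {z : ℂ × ℂ} (hz : z ≠ 0) :
    HasFDerivAt (ham q) (dHam q z) z := by
  have hS := (sqNorm_pos hz).ne'
  have hq' : HasDerivAt q (deriv q (ratio z)) (ratio z) :=
    (hq.differentiable (by simp) _).hasDerivAt
  refine (((hasFDerivAt_sqNorm z).const_mul Real.pi).mul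
    (hq'.comp_hasFDerivAt z (hasFDerivAt_ratio hz))).congr_fderiv ?_
  refine ContinuousLinearMap.ext fun v => ?_
  simp only [dRatio, dHam, smul_apply, sub_apply,
    add_apply, smul_eq_mul, freqOne, freqTwo, Function.comp_apply]
  field_simp
  ring

/-- Euler's identity in degree two. It makes the radial direction transverse to the hypersurface and
is the source of every division of `dHam` by 2 below. -/
theorem dHam_self (q : ℝ → ℝ) {z : ℂ × ℂ} (hz : z ≠ 0) : dHam q z z = 2 * ham q z := by
  have h1 := normSq_fst_eq hz
  have h2 := normSq_snd_eq hz
  rw [Complex.normSq_apply] at h1 h2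
  rw [dHam_apply, h1, h2, ham, freqOne, freqTwo]
  ring

/-! ### The radial retraction onto the hypersurface -/

/-- The radial retraction of `ℂ² ∖ 0` onto `level q`. -/
def retract (q : ℝ → ℝ) (z : ℂ × ℂ) : ℂ × ℂ := (√(ham q z))⁻¹ • z

theorem retract_mem_level {q : ℝ → ℝ} (hq : ∀ t, 0 < q t) {z : ℂ × ℂ} (hz : z ≠ 0) :
    retract q z ∈ level q := by
  have hH := ham_pos hq hz
  have hs := Real.sqrt_pos.2 hH
  rw [level, mem_ofPred_eq, retract, ham_smul q (inv_ne_zero hs.ne'), inv_pow, Real.sq_sqrt hH.le,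
    inv_mul_cancel₀ hH.ne']

theorem retract_of_mem {q : ℝ → ℝ} {z : ℂ × ℂ} (hz : z ∈ level q) : retract q z = z := by
  rw [level, mem_ofPred_eq] at hz
  simp [retract, hz]

theorem retract_smul (q : ℝ → ℝ) {c : ℝ} (hc : 0 < c) (z : ℂ × ℂ) :
    retract q (c • z) = retract q z := by
  rw [retract, retract, ham_smul q hc.ne', Real.sqrt_mul (sq_nonneg c), Real.sqrt_sq hc.le,
    smul_smul, mul_inv_rev, inv_mul_cancel_right₀ hc.ne']

theorem contDiffAt_retract {q : ℝ → ℝ} (hq : ContDiff ℝ ∞ q) (hpos : ∀ t, 0 < q t) {z : ℂ × ℂ}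
    (hz : z ≠ 0) : ContDiffAt ℝ ∞ (retract q) z := by
  have hH := ham_pos hpos hz
  exact (((contDiffAt_ham hq hz).sqrt hH.ne').inv (Real.sqrt_pos.2 hH).ne').smul contDiffAt_id

/-- The scaling factor is stationary along directions annihilated by `dHam`, so retracting the line
keeps its velocity. This supplies curves in the hypersurface with any admissible velocity. -/
theorem hasDerivAt_retract_line {q : ℝ → ℝ} (hq : ContDiff ℝ ∞ q) {z v : ℂ × ℂ}
    (hz : z ∈ level q) (hv : dHam q z v = 0) : HasDerivAt (fun s : ℝ => retract q (z + s • v)) v 0 := by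
  have hz0 := ne_zero_of_mem_level hz
  have hz1 : ham q z = 1 := hz
  have hline : HasDerivAt (fun s : ℝ => z + s • v) v 0 := by
    simpa using ((hasDerivAt_id (0 : ℝ)).smul_const v).const_add z
  have h1 : HasDerivAt (fun s : ℝ => ham q (z + s • v)) 0 0 := by
    have := (hasFDerivAt_ham hq (z := z + (0 : ℝ) • v) (by simpa using hz0)).comp_hasDerivAt 0 hline
    refine this.congr_deriv ?_
    simpa using hv
  have h2 := (h1.sqrt (by simp [hz1])).inv (by simp [hz1])
  refine (h2.smul hline).congr_deriv ?_
  simp [hz1]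

theorem tangentSet_level {q : ℝ → ℝ} (hq : ContDiff ℝ ∞ q) (hpos : ∀ t, 0 < q t) {z : ℂ × ℂ}
    (hz : z ∈ level q) : tangentSet (level q) z = {v | dHam q z v = 0} := by
  have hz0 := ne_zero_of_mem_level hz
  ext v
  constructor
  · intro hv
    -- `ham q` is constant on the level, so `dHam` and 0 are both derivatives within it; two such
    -- derivatives agree on the tangent cone.
    have h1 := (hasFDerivAt_ham hq hz0).hasFDerivWithinAt (s := level q)
    have h2 : HasFDerivWithinAt (ham q) (0 : ℂ × ℂ →L[ℝ] ℝ) (level q) z :=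
      (hasFDerivWithinAt_const (1 : ℝ) z (level q)).congr (fun w hw => hw) hz
    exact h1.unique_on h2 hv
  · intro hv
    have hd := hasDerivAt_retract_line hq hz hv
    have hγ0 : retract q (z + (0 : ℝ) • v) = z := by simp [retract_of_mem hz]
    refine mem_tangentConeAt_of_seq (𝓝[≠] (0 : ℝ)) (fun s => s⁻¹)
      (fun s => retract q (z + s • v) - z) ?_ ?_ ?_
    · have := hd.continuousAt.tendsto.mono_left (nhdsWithin_le_nhds (s := {0}ᶜ))
      rw [hγ0] at this
      simpa using this.sub_const z
    · have hne : ∀ᶠ s : ℝ in 𝓝 0, z + s • v ≠ 0 := by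
        have hc : Continuous fun s : ℝ => z + s • v := by fun_prop
        exact hc.continuousAt.eventually_ne (by simpa using hz0)
      filter_upwards [nhdsWithin_le_nhds hne] with s hs
      simpa using retract_mem_level hpos hs
    · have := hd.tendsto_slope_zero
      simpa [hγ0, retract_of_mem hz] using this

/-! ### The Reeb vector field and its flow -/

theorem stdLambda_sub (z u v : ℂ × ℂ) : stdLambda z (u - v) = stdLambda z u - stdLambda z v := by
  simp [stdLambda]
  ring

theorem stdOmega_sub_left (u v w : ℂ × ℂ) : stdOmega (u - v) w = stdOmega u w - stdOmega v w := by
  simp [stdOmega]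
  ring

theorem stdOmega_add_smul_right (u v w : ℂ × ℂ) (a b : ℝ) :
    stdOmega u (a • v + b • w) = a * stdOmega u v + b * stdOmega u w := by
  simp [stdOmega]
  ring

/-- The radial field is twice the Liouville field: contracting it into $\omega$ gives $2\lambda$. -/
theorem stdOmega_self_right (z v : ℂ × ℂ) : stdOmega v z = -(2 * stdLambda z v) := by
  simp [stdOmega, stdLambda]
  ring

theorem eq_zero_of_stdOmega {w : ℂ × ℂ} (h : ∀ u, stdOmega w u = 0) : w = 0 := by
  have h1 := h (1, 0)
  have h2 := h (Complex.I, 0)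
  have h3 := h (0, 1)
  have h4 := h (0, Complex.I)
  simp [stdOmega] at h1 h2 h3 h4
  exact Prod.ext (Complex.ext h2 h1) (Complex.ext h4 h3)

/-- The Reeb vector field of `level q`. -/
def reebField (q : ℝ → ℝ) (z : ℂ × ℂ) : ℂ × ℂ :=
  ((2 * Real.pi * freqOne q (ratio z) : ℝ) * Complex.I * z.1,
    (2 * Real.pi * freqTwo q (ratio z) : ℝ) * Complex.I * z.2)

theorem stdOmega_reebField (q : ℝ → ℝ) (z v : ℂ × ℂ) :
    stdOmega (reebField q z) v = -dHam q z v := by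
  rw [dHam_apply]
  simp only [stdOmega, reebField, Complex.mul_re, Complex.mul_im, Complex.ofReal_re,
    Complex.ofReal_im, Complex.I_re, Complex.I_im]
  ring

theorem stdLambda_reebField (q : ℝ → ℝ) {z : ℂ × ℂ} (hz : z ≠ 0) :
    stdLambda z (reebField q z) = ham q z := by
  have h := stdOmega_self_right z (reebField q z)
  rw [stdOmega_reebField, dHam_self q hz] at h
  linarith

theorem isReebVector_iff {q : ℝ → ℝ} (hq : ContDiff ℝ ∞ q) (hpos : ∀ t, 0 < q t) {z R : ℂ × ℂ}
    (hz : z ∈ level q) : IsReebVector (level q) z R ↔ R = reebField q z := by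
  have hz0 := ne_zero_of_mem_level hz
  have hz1 : ham q z = 1 := hz
  rw [IsReebVector, tangentSet_level hq hpos hz]
  simp only [mem_ofPred_eq]
  constructor
  · rintro ⟨hR1, hR2, hR3⟩
    rw [← sub_eq_zero]
    -- By nondegeneracy it suffices to pair the difference with every `u`. Split `u` into a tangent
    -- part, on which both fields pair to zero, and a radial part, on which the pairing is
    -- $-2\lambda$ and both fields have $\lambda=1$.
    refine eq_zero_of_stdOmega fun u => ?_
    have hw : stdLambda z (R - reebField q z) = 0 := by
      rw [stdLambda_sub, hR2, stdLambda_reebField q hz0, hz1, sub_self]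
    have hu : u = (1 : ℝ) • (u - (dHam q z u / 2) • z) + (dHam q z u / 2) • z := by simp
    have hu' : dHam q z (u - (dHam q z u / 2) • z) = 0 := by
      rw [map_sub, map_smul, dHam_self q hz0, hz1, smul_eq_mul]
      ring
    rw [hu, stdOmega_add_smul_right, stdOmega_self_right z, hw, stdOmega_sub_left, hR3 _ hu',
      stdOmega_reebField, hu']
    simp
  · rintro rfl
    refine ⟨?_, by rw [stdLambda_reebField q hz0, hz1], fun v hv => ?_⟩
    · rw [← neg_eq_zero, ← stdOmega_reebField]
      simp [stdOmega]
      ring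
    · rw [stdOmega_reebField, hv, neg_zero]

/-- The action of the torus on `ℂ²`. -/
def torusAct (a b : ℝ) (z : ℂ × ℂ) : ℂ × ℂ :=
  (Complex.exp (a * Complex.I) * z.1, Complex.exp (b * Complex.I) * z.2)

theorem normSq_exp_mul (a : ℝ) (w : ℂ) :
    Complex.normSq (Complex.exp (a * Complex.I) * w) = Complex.normSq w := by
  rw [Complex.normSq_mul, Complex.normSq_eq_norm_sq (Complex.exp _), Complex.norm_exp_ofReal_mul_I]
  simp

theorem sqNorm_torusAct (a b : ℝ) (z : ℂ × ℂ) : sqNorm (torusAct a b z) = sqNorm z := by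
  simp only [sqNorm, torusAct, normSq_exp_mul]

theorem ratio_torusAct (a b : ℝ) (z : ℂ × ℂ) : ratio (torusAct a b z) = ratio z := by
  rw [ratio, ratio, sqNorm_torusAct]
  simp only [torusAct, normSq_exp_mul]

theorem ham_torusAct (q : ℝ → ℝ) (a b : ℝ) (z : ℂ × ℂ) : ham q (torusAct a b z) = ham q z := by
  rw [ham, ham, sqNorm_torusAct, ratio_torusAct]

theorem torusAct_smul (a b c : ℝ) (z : ℂ × ℂ) : torusAct a b (c • z) = c • torusAct a b z := by
  ext <;> simp [torusAct] <;> ring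

theorem retract_torusAct (q : ℝ → ℝ) (a b : ℝ) (z : ℂ × ℂ) :
    retract q (torusAct a b z) = torusAct a b (retract q z) := by
  rw [retract, retract, ham_torusAct, torusAct_smul]

/-- The Reeb flow of `level q`, extended to `ℂ²`. -/
def toricFlow (q : ℝ → ℝ) (t : ℝ) (z : ℂ × ℂ) : ℂ × ℂ :=
  torusAct (2 * Real.pi * freqOne q (ratio z) * t) (2 * Real.pi * freqTwo q (ratio z) * t) z

theorem hasDerivAt_exp_mul (c t : ℝ) (w : ℂ) :
    HasDerivAt (fun s : ℝ => Complex.exp ((c * s : ℝ) * Complex.I) * w)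
      (c * Complex.I * (Complex.exp ((c * t : ℝ) * Complex.I) * w)) t := by
  have h1 : HasDerivAt (fun s : ℝ => ((c * s : ℝ) : ℂ) * Complex.I) (c * Complex.I) t := by
    have := ((hasDerivAt_id t).const_mul c).ofReal_comp.mul_const Complex.I
    simpa using this
  refine (h1.cexp.mul_const w).congr_deriv ?_
  ring

/-- `ratio` is invariant under the torus, so the two frequencies are constant along each orbit and
each coordinate turns uniformly. -/
theorem isReebFlow_toricFlow {q : ℝ → ℝ} (hq : ContDiff ℝ ∞ q) (hpos : ∀ t, 0 < q t) :
    IsReebFlow (level q) (toricFlow q) := by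
  intro y hy
  refine ⟨by simp [toricFlow, torusAct], fun t => ?_⟩
  have hmem : toricFlow q t y ∈ level q := by
    rw [level, mem_ofPred_eq, toricFlow, ham_torusAct]
    exact hy
  refine ⟨hmem, reebField q (toricFlow q t y), (isReebVector_iff hq hpos hmem).2 rfl, ?_⟩
  have hr : ratio (toricFlow q t y) = ratio y := ratio_torusAct _ _ _
  rw [reebField, hr]
  exact (hasDerivAt_exp_mul _ t y.1).prodMk (hasDerivAt_exp_mul _ t y.2)

theorem eq_exp_mul_of_hasDerivAt {γ : ℝ → ℂ} {c : ℝ}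
    (h : ∀ t, HasDerivAt γ (c * Complex.I * γ t) t) (t : ℝ) :
    γ t = Complex.exp ((c * t : ℝ) * Complex.I) * γ 0 := by
  have hd : ∀ s, HasDerivAt (fun s => Complex.exp ((-c * s : ℝ) * Complex.I) * γ s) 0 s := fun s => by
    have h1 := (hasDerivAt_exp_mul (-c) s 1).mul (h s)
    simp only [mul_one] at h1
    refine h1.congr_deriv ?_
    push_cast
    ring
  have hconst := is_const_of_deriv_eq_zero (fun s => (hd s).differentiableAt)
    (fun s => (hd s).deriv) t 0
  simp only [mul_zero, Complex.ofReal_zero, zero_mul, Complex.exp_zero, one_mul] at hconst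
  rw [← hconst, ← mul_assoc, ← Complex.exp_add]
  have : ((c * t : ℝ) : ℂ) * Complex.I + ((-c * t : ℝ) : ℂ) * Complex.I = 0 := by
    push_cast
    ring
  rw [this, Complex.exp_zero, one_mul]

/-- Uniqueness of the flow without a general ODE theorem: the Reeb field preserves both $|z_i|^2$,
hence `ratio`, so along an orbit the equation is linear with constant coefficients and decouples. -/
theorem IsReebFlow.eq_toricFlow {q : ℝ → ℝ} (hq : ContDiff ℝ ∞ q) (hpos : ∀ t, 0 < q t)
    {φ : ℝ → ℂ × ℂ → ℂ × ℂ} (hφ : IsReebFlow (level q) φ) {y : ℂ × ℂ} (hy : y ∈ level q) (t : ℝ) :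
    φ t y = toricFlow q t y := by
  obtain ⟨h0, hφy⟩ := hφ y hy
  have hd : ∀ t, HasDerivAt (fun s => φ s y) (reebField q (φ t y)) t := fun t => by
    obtain ⟨hm, R, hR, hR'⟩ := hφy t
    rwa [(isReebVector_iff hq hpos hm).1 hR] at hR'
  have e1 : ∀ t, Complex.normSq (φ t y).1 = Complex.normSq y.1 := fun t => by
    have hd' : ∀ t, HasDerivAt (fun s => Complex.normSq (φ s y).1) 0 t := fun t => by
      refine ((hasFDerivAt_normSq_fst (φ t y)).comp_hasDerivAt t (hd t)).congr_deriv ?_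
      simp [reebField]
      ring
    have := is_const_of_deriv_eq_zero (fun s => (hd' s).differentiableAt)
      (fun s => (hd' s).deriv) t 0
    simpa only [h0] using this
  have e2 : ∀ t, Complex.normSq (φ t y).2 = Complex.normSq y.2 := fun t => by
    have hd' : ∀ t, HasDerivAt (fun s => Complex.normSq (φ s y).2) 0 t := fun t => by
      refine ((hasFDerivAt_normSq_snd (φ t y)).comp_hasDerivAt t (hd t)).congr_deriv ?_
      simp [reebField]
      ring
    have := is_const_of_deriv_eq_zero (fun s => (hd' s).differentiableAt)
      (fun s => (hd' s).deriv) t 0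
    simpa only [h0] using this
  have hr : ∀ t, ratio (φ t y) = ratio y := fun t => by rw [ratio, ratio, sqNorm, sqNorm, e1, e2]
  have d1 := eq_exp_mul_of_hasDerivAt (γ := fun s => (φ s y).1)
    (c := 2 * Real.pi * freqOne q (ratio y)) (fun t => by
      have := (hasFDerivAt_fst (𝕜 := ℝ) (p := φ t y)).comp_hasDerivAt t (hd t)
      refine this.congr_deriv ?_
      simp [reebField, hr])
  have d2 := eq_exp_mul_of_hasDerivAt (γ := fun s => (φ s y).2)
    (c := 2 * Real.pi * freqTwo q (ratio y)) (fun t => by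
      have := (hasFDerivAt_snd (𝕜 := ℝ) (p := φ t y)).comp_hasDerivAt t (hd t)
      refine this.congr_deriv ?_
      simp [reebField, hr])
  simp only [h0] at d1 d2
  exact Prod.ext (d1 t) (d2 t)

/-! ### The complex coordinate on the contact planes -/

/-- The determinant `z₁v₂ - z₂v₁`; restricted to `ker λ_z` it is a coordinate modulo `z`. -/
def crossDet (z v : ℂ × ℂ) : ℂ := z.1 * v.2 - z.2 * v.1

/-- The area form `Im (conj u · v)` of the plane. -/
def planeArea (u v : ℂ) : ℝ := u.re * v.im - u.im * v.re

/-- The two sides differ by a combination of $\lambda_z(u)$ and $\lambda_z(v)$, the coefficients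
being real scalar products with $z$. Thus `crossDet z` identifies the contact plane with
$\mathbb{C}$, preserving orientation and scaling area by $|z|^2$. -/
theorem stdOmega_mul_sqNorm {z u v : ℂ × ℂ} (hu : stdLambda z u = 0) (hv : stdLambda z v = 0) :
    stdOmega u v * sqNorm z = planeArea (crossDet z u) (crossDet z v) := by
  simp only [stdLambda] at hu hv
  simp only [stdOmega, sqNorm, planeArea, crossDet, Complex.normSq_apply, Complex.sub_re,
    Complex.sub_im, Complex.mul_re, Complex.mul_im]
  linear_combination
    2 * (z.1.re * u.1.re + z.1.im * u.1.im + z.2.re * u.2.re + z.2.im * u.2.im) * hv -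
    2 * (z.1.re * v.1.re + z.1.im * v.1.im + z.2.re * v.2.re + z.2.im * v.2.im) * hu

theorem stdOmega_eq {z u v : ℂ × ℂ} (hz : z ≠ 0) (hu : stdLambda z u = 0)
    (hv : stdLambda z v = 0) :
    stdOmega u v = planeArea (crossDet z u) (crossDet z v) / sqNorm z := by
  rw [← stdOmega_mul_sqNorm hu hv, mul_div_cancel_right₀ _ (sqNorm_pos hz).ne']

/-- The factor is the complex determinant of the torus element; this is where the sum of the two
frequencies comes from. -/
theorem crossDet_torusAct (a b : ℝ) (z v : ℂ × ℂ) :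
    crossDet (torusAct a b z) (torusAct a b v) =
      Complex.exp ((a + b : ℝ) * Complex.I) * crossDet z v := by
  have : Complex.exp ((a + b : ℝ) * Complex.I) =
      Complex.exp (a * Complex.I) * Complex.exp (b * Complex.I) := by
    rw [← Complex.exp_add]
    push_cast
    ring_nf
  rw [this]
  simp only [crossDet, torusAct]
  ring

theorem stdLambda_torusAct (a b : ℝ) (z v : ℂ × ℂ) :
    stdLambda (torusAct a b z) (torusAct a b v) = stdLambda z v := by
  have ha := Real.cos_sq_add_sin_sq a
  have hb := Real.cos_sq_add_sin_sq b
  simp only [stdLambda, torusAct, Complex.mul_re, Complex.mul_im, Complex.exp_ofReal_mul_I_re,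
    Complex.exp_ofReal_mul_I_im]
  linear_combination ((z.1.re * v.1.im - z.1.im * v.1.re) / 2) * ha +
    ((z.2.re * v.2.im - z.2.im * v.2.re) / 2) * hb

/-! ### Existence of a global symplectic frame -/

/-- The quaternionic rotation `(z₁, z₂) ↦ (-conj z₂, conj z₁)`. -/
def quatJ (z : ℂ × ℂ) : ℂ × ℂ := (-(starRingEnd ℂ) z.2, (starRingEnd ℂ) z.1)

/-- The composition of `quatJ` with the multiplication by `i`. -/
def quatK (z : ℂ × ℂ) : ℂ × ℂ := (Complex.I * (quatJ z).1, Complex.I * (quatJ z).2)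

/-- The projection to the tangent space of `level q` along the radial direction, normalized. -/
def frameProj (q : ℝ → ℝ) (z v : ℂ × ℂ) : ℂ × ℂ :=
  (√(sqNorm z))⁻¹ • (v - (dHam q z v / 2) • z)

theorem continuous_freqOne {q : ℝ → ℝ} (hq : ContDiff ℝ ∞ q) : Continuous (freqOne q) :=
  hq.continuous.sub (continuous_id.mul (hq.continuous_deriv (by simp)))

theorem continuous_freqTwo {q : ℝ → ℝ} (hq : ContDiff ℝ ∞ q) : Continuous (freqTwo q) :=
  hq.continuous.add ((continuous_const.sub continuous_id).mul (hq.continuous_deriv (by simp)))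

theorem continuousOn_ratio (q : ℝ → ℝ) : ContinuousOn ratio (level q) := fun _ hz =>
  (contDiffAt_ratio (ne_zero_of_mem_level hz)).continuousAt.continuousWithinAt

theorem continuousOn_frameProj {q : ℝ → ℝ} (hq : ContDiff ℝ ∞ q) {V : ℂ × ℂ → ℂ × ℂ}
    (hV : Continuous V) : ContinuousOn (fun z => frameProj q z (V z)) (level q) := by
  have h1 := (continuous_freqOne hq).comp_continuousOn (continuousOn_ratio q)
  have h2 := (continuous_freqTwo hq).comp_continuousOn (continuousOn_ratio q)
  have hd : ContinuousOn (fun z => dHam q z (V z)) (level q) := by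
    simp only [dHam_apply]
    have c1 : Continuous fun z : ℂ × ℂ => z.1.re * (V z).1.re + z.1.im * (V z).1.im := by fun_prop
    have c2 : Continuous fun z : ℂ × ℂ => z.2.re * (V z).2.re + z.2.im * (V z).2.im := by fun_prop
    exact ((continuousOn_const.mul h1).mul c1.continuousOn).add
      ((continuousOn_const.mul h2).mul c2.continuousOn)
  have hs : ContinuousOn (fun z : ℂ × ℂ => (√(sqNorm z))⁻¹) (level q) :=
    (continuous_sqNorm.sqrt).continuousOn.inv₀ fun z hz =>
      (Real.sqrt_pos.2 (sqNorm_pos (ne_zero_of_mem_level hz))).ne'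
  exact hs.smul (hV.continuousOn.sub ((hd.div_const 2).smul continuousOn_id))

theorem frameProj_mem {q : ℝ → ℝ} (hq : ContDiff ℝ ∞ q) (hpos : ∀ t, 0 < q t) {z v : ℂ × ℂ}
    (hz : z ∈ level q) (hv : stdLambda z v = 0) : frameProj q z v ∈ contactPlane (level q) z := by
  have hz0 := ne_zero_of_mem_level hz
  have hz1 : ham q z = 1 := hz
  refine ⟨?_, ?_⟩
  · rw [tangentSet_level hq hpos hz]
    change dHam q z (frameProj q z v) = 0
    rw [frameProj, map_smul, map_sub, map_smul, dHam_self q hz0, hz1, smul_eq_mul, smul_eq_mul]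
    ring
  · simp only [stdLambda] at hv
    simp [stdLambda, frameProj]
    linear_combination 2 * (√(sqNorm z))⁻¹ * hv

theorem crossDet_frameProj (q : ℝ → ℝ) (z v : ℂ × ℂ) :
    crossDet z (frameProj q z v) = ((√(sqNorm z))⁻¹ : ℝ) * crossDet z v := by
  simp [crossDet, frameProj]
  ring

theorem stdLambda_quatJ (z : ℂ × ℂ) : stdLambda z (quatJ z) = 0 := by
  simp [stdLambda, quatJ]
  ring

theorem stdLambda_quatK (z : ℂ × ℂ) : stdLambda z (quatK z) = 0 := by
  simp [stdLambda, quatJ, quatK]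
  ring

theorem planeArea_quat (z : ℂ × ℂ) :
    planeArea (crossDet z (quatJ z)) (crossDet z (quatK z)) = sqNorm z ^ 2 := by
  simp [planeArea, crossDet, quatJ, quatK, sqNorm, Complex.normSq_apply]
  ring

theorem planeArea_real_mul (a : ℝ) (u v : ℂ) : planeArea (a * u) (a * v) = a ^ 2 * planeArea u v := by
  simp [planeArea]
  ring

/-- In the coordinate `crossDet z`, which ignores multiples of $z$, the fields `quatJ` and `quatK`
read $|z|^2$ and $i|z|^2$. The factor $|z|^{-1}$ in `frameProj` is what makes the symplectic area 1.
-/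
theorem isSymplecticFrame_frameProj {q : ℝ → ℝ} (hq : ContDiff ℝ ∞ q) (hpos : ∀ t, 0 < q t) :
    IsSymplecticFrame (level q) (fun z => frameProj q z (quatJ z))
      (fun z => frameProj q z (quatK z)) where
  continuousOn_fst := continuousOn_frameProj hq (by unfold quatJ; fun_prop)
  continuousOn_snd := continuousOn_frameProj hq (by unfold quatK quatJ; fun_prop)
  mem_fst z hz := frameProj_mem hq hpos hz (stdLambda_quatJ z)
  mem_snd z hz := frameProj_mem hq hpos hz (stdLambda_quatK z)
  omega_eq_one z hz := by
    have hS := sqNorm_pos (ne_zero_of_mem_level hz)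
    rw [stdOmega_eq (ne_zero_of_mem_level hz) (frameProj_mem hq hpos hz (stdLambda_quatJ z)).2
      (frameProj_mem hq hpos hz (stdLambda_quatK z)).2, crossDet_frameProj, crossDet_frameProj,
      planeArea_real_mul, planeArea_quat, inv_pow, Real.sq_sqrt hS.le]
    field_simp

/-! ### The linearized flow in the complex coordinate -/

/-- Besides being rotated, $v$ acquires the variation of the rotation angles with `ratio`. The
derivatives of the frequencies are $-tq''$ and $(1-t)q''$, since the terms in $q'$ cancel. -/
theorem exists_hasFDerivAt_toricFlow {q : ℝ → ℝ} (hq : ContDiff ℝ ∞ q) {y : ℂ × ℂ} (hy : y ≠ 0)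
    (t : ℝ) : ∃ D : ℂ × ℂ →L[ℝ] ℂ × ℂ, HasFDerivAt (toricFlow q t) D y ∧ ∀ v,
      D v = torusAct (2 * Real.pi * freqOne q (ratio y) * t) (2 * Real.pi * freqTwo q (ratio y) * t)
        (v.1 + ((2 * Real.pi * t * deriv (deriv q) (ratio y) * dRatio y v * -ratio y : ℝ) : ℂ)
            * Complex.I * y.1,
          v.2 + ((2 * Real.pi * t * deriv (deriv q) (ratio y) * dRatio y v * (1 - ratio y) : ℝ) : ℂ)
            * Complex.I * y.2) := by
  have hq1 : HasDerivAt q (deriv q (ratio y)) (ratio y) :=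
    (hq.differentiable (by simp) _).hasDerivAt
  have hq2 : HasDerivAt (deriv q) (deriv (deriv q) (ratio y)) (ratio y) := by
    have : ContDiff ℝ ∞ (deriv q) := ((contDiff_infty_iff_deriv).1 hq).2
    exact (this.differentiable (by simp) _).hasDerivAt
  have hf1 : HasDerivAt (freqOne q) (-ratio y * deriv (deriv q) (ratio y)) (ratio y) := by
    refine (hq1.sub ((hasDerivAt_id _).mul hq2)).congr_deriv ?_
    simp
  have hf2 : HasDerivAt (freqTwo q) ((1 - ratio y) * deriv (deriv q) (ratio y)) (ratio y) := by
    refine (hq1.add (((hasDerivAt_id _).const_sub 1).mul hq2)).congr_deriv ?_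
    simp
  have hr := hasFDerivAt_ratio hy
  have key : ∀ {f : ℝ → ℝ} {f' : ℝ}, HasDerivAt f f' (ratio y) →
      HasFDerivAt (fun z : ℂ × ℂ => Complex.exp ((2 * Real.pi * f (ratio z) * t : ℝ) * Complex.I))
        ((Complex.exp ((2 * Real.pi * f (ratio y) * t : ℝ) * Complex.I)) •
          ((((2 * Real.pi * f' * t) • dRatio y)).smulRight Complex.I)) y := by
    intro f f' hf
    have h1 : HasFDerivAt (fun z : ℂ × ℂ => ((2 * Real.pi * f (ratio z) * t : ℝ) : ℂ) * Complex.I)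
        (((2 * Real.pi * f' * t) • dRatio y).smulRight Complex.I) y := by
      have h2 := ((hf.comp_hasFDerivAt y hr).const_mul (2 * Real.pi)).mul_const t
      have h3 := h2.smul_const Complex.I
      simp only [Complex.real_smul] at h3
      refine h3.congr_fderiv ?_
      refine ContinuousLinearMap.ext fun v => ?_
      simp
      ring
    exact h1.cexp
  have k1 := (key hf1).mul (hasFDerivAt_fst (𝕜 := ℝ) (p := y))
  have k2 := (key hf2).mul (hasFDerivAt_snd (𝕜 := ℝ) (p := y))
  refine ⟨_, k1.prodMk k2, fun v => ?_⟩
  simp only [torusAct]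
  ext1
  · simp
    ring
  · simp
    ring

/-- `ratio` is invariant under complex scalars, so its derivative at $z$ kills the complex line
through $z$ and factors through `crossDet z`. -/
theorem dRatio_eq {z : ℂ × ℂ} (hz : z ≠ 0) (v : ℂ × ℂ) :
    dRatio z v = 2 / sqNorm z ^ 2 * ((crossDet z v).re * (z.1 * z.2).re +
      (crossDet z v).im * (z.1 * z.2).im) := by
  have hS := (sqNorm_pos hz).ne'
  have h1 := normSq_fst_eq hz
  have h2 := normSq_snd_eq hz
  have h3 : (crossDet z v).re * (z.1 * z.2).re + (crossDet z v).im * (z.1 * z.2).im =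
      Complex.normSq z.1 * radTwo z v - Complex.normSq z.2 * radOne z v := by
    simp [crossDet, Complex.normSq_apply]
    ring
  rw [h3, h1, h2]
  simp only [dRatio, smul_apply, sub_apply, smul_eq_mul]
  field_simp

/-- The shear on the complex coordinate produced by the linearized flow. -/
def shear (a : ℝ) (p c : ℂ) : ℂ := c + ((a * (c.re * p.re + c.im * p.im) : ℝ) : ℂ) * Complex.I * p

/-- The growth rate of the shear of the linearized flow at `y`. -/
def shearRate (q : ℝ → ℝ) (y : ℂ × ℂ) : ℝ :=
  2 * Real.pi * deriv (deriv q) (ratio y) * (2 / sqNorm y ^ 2)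

/-- The total angular frequency at `y`. -/
def totalFreq (q : ℝ → ℝ) (y : ℂ × ℂ) : ℝ :=
  2 * Real.pi * (freqOne q (ratio y) + freqTwo q (ratio y))

/-- Varying the angles of $y_1,y_2$ by $-tk$ and $(1-t)k$ changes the determinant by $ik\,y_1y_2$,
and $k$ is proportional to the real scalar product of `crossDet y v` with $y_1y_2$: hence a shear
along $i\,y_1y_2$. -/
theorem fderivWithin_reebFlow {q : ℝ → ℝ} (hq : ContDiff ℝ ∞ q) (hpos : ∀ t, 0 < q t)
    {φ : ℝ → ℂ × ℂ → ℂ × ℂ} (hφ : IsReebFlow (level q) φ) {y v : ℂ × ℂ} (hy : y ∈ level q)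
    (hv : v ∈ contactPlane (level q) y) (t : ℝ) :
    stdLambda (φ t y) (fderivWithin ℝ (φ t) (level q) y v) = 0 ∧
    crossDet (φ t y) (fderivWithin ℝ (φ t) (level q) y v) =
      Complex.exp ((totalFreq q y * t : ℝ) * Complex.I) *
        shear (shearRate q y * t) (y.1 * y.2) (crossDet y v) := by
  have hy0 := ne_zero_of_mem_level hy
  obtain ⟨D, hD, hDv⟩ := exists_hasFDerivAt_toricFlow hq hy0 t
  have h1 : HasFDerivWithinAt (φ t) D (level q) y :=
    hD.hasFDerivWithinAt.congr (fun z hz => hφ.eq_toricFlow hq hpos hz t)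
      (hφ.eq_toricFlow hq hpos hy t)
  -- Derivatives within the hypersurface are determined only on tangent vectors, and `v` is one.
  have h2 : fderivWithin ℝ (φ t) (level q) y v = D v :=
    h1.differentiableWithinAt.hasFDerivWithinAt.unique_on h1 hv.1
  rw [h2, hφ.eq_toricFlow hq hpos hy t, hDv, toricFlow, stdLambda_torusAct, crossDet_torusAct]
  constructor
  · have hl := hv.2
    have e1 := normSq_fst_eq hy0
    have e2 := normSq_snd_eq hy0
    rw [Complex.normSq_apply] at e1 e2
    simp only [stdLambda] at hl
    simp [stdLambda]
    linear_combination 2 * hl - (2 * Real.pi * t * deriv (deriv q) (ratio y) * dRatio y v) * ratio y * e1 +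
      (2 * Real.pi * t * deriv (deriv q) (ratio y) * dRatio y v) * (1 - ratio y) * e2
  · congr 1
    · rw [totalFreq]
      congr 3
      ring
    · rw [shear, shearRate, dRatio_eq hy0]
      simp only [crossDet]
      push_cast
      ring

/-! ### The matrix of the linearized flow -/

/-- The matrix whose columns are the coordinates of `u₁, u₂` in the frame `c₁, c₂`, where `S` is
the area spanned by the frame. -/
def coordMatrix (S : ℝ) (c₁ c₂ u₁ u₂ : ℂ) : Matrix (Fin 2) (Fin 2) ℝ :=
  !![planeArea u₁ c₂ / S, planeArea u₂ c₂ / S; planeArea c₁ u₁ / S, planeArea c₁ u₂ / S]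

theorem IsSymplecticFrame.planeArea_eq {q : ℝ → ℝ} {e₁ e₂ : ℂ × ℂ → ℂ × ℂ}
    (he : IsSymplecticFrame (level q) e₁ e₂) {y : ℂ × ℂ} (hy : y ∈ level q) :
    planeArea (crossDet y (e₁ y)) (crossDet y (e₂ y)) = sqNorm y := by
  rw [← stdOmega_mul_sqNorm (he.mem_fst y hy).2 (he.mem_snd y hy).2, he.omega_eq_one y hy, one_mul]

theorem linearizedFlow_eq {q : ℝ → ℝ} (hq : ContDiff ℝ ∞ q) (hpos : ∀ t, 0 < q t)
    {φ : ℝ → ℂ × ℂ → ℂ × ℂ} (hφ : IsReebFlow (level q) φ) {e₁ e₂ : ℂ × ℂ → ℂ × ℂ}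
    (he : IsSymplecticFrame (level q) e₁ e₂) {y : ℂ × ℂ} (hy : y ∈ level q) (t : ℝ) :
    linearizedFlow (level q) φ e₁ e₂ y t = coordMatrix (sqNorm y)
      (crossDet (toricFlow q t y) (e₁ (toricFlow q t y)))
      (crossDet (toricFlow q t y) (e₂ (toricFlow q t y)))
      (Complex.exp ((totalFreq q y * t : ℝ) * Complex.I) *
        shear (shearRate q y * t) (y.1 * y.2) (crossDet y (e₁ y)))
      (Complex.exp ((totalFreq q y * t : ℝ) * Complex.I) *
        shear (shearRate q y * t) (y.1 * y.2) (crossDet y (e₂ y))) := by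
  obtain ⟨l1, d1⟩ := fderivWithin_reebFlow hq hpos hφ hy (he.mem_fst y hy) t
  obtain ⟨l2, d2⟩ := fderivWithin_reebFlow hq hpos hφ hy (he.mem_snd y hy) t
  have hm : φ t y ∈ level q := ((hφ y hy).2 t).1
  have hm0 := ne_zero_of_mem_level hm
  have hS : sqNorm (φ t y) = sqNorm y := by
    rw [hφ.eq_toricFlow hq hpos hy t, toricFlow, sqNorm_torusAct]
  rw [← hφ.eq_toricFlow hq hpos hy t, ← d1, ← d2, coordMatrix, ← hS]
  simp only [linearizedFlow]
  rw [stdOmega_eq hm0 l1 (he.mem_snd _ hm).2, stdOmega_eq hm0 l2 (he.mem_snd _ hm).2,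
    stdOmega_eq hm0 (he.mem_fst _ hm).2 l1, stdOmega_eq hm0 (he.mem_fst _ hm).2 l2]

theorem planeArea_shear (a : ℝ) (p u v : ℂ) :
    planeArea (shear a p u) (shear a p v) = planeArea u v := by
  simp [planeArea, shear]
  ring

theorem planeArea_exp_mul (a : ℝ) (u v : ℂ) :
    planeArea (Complex.exp (a * Complex.I) * u) (Complex.exp (a * Complex.I) * v) =
      planeArea u v := by
  have ha := Real.cos_sq_add_sin_sq a
  simp only [planeArea, Complex.mul_re, Complex.mul_im, Complex.exp_ofReal_mul_I_re,
    Complex.exp_ofReal_mul_I_im]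
  linear_combination (u.re * v.im - u.im * v.re) * ha

theorem det_coordMatrix (S : ℝ) (c₁ c₂ u₁ u₂ : ℂ) :
    (coordMatrix S c₁ c₂ u₁ u₂).det = planeArea c₁ c₂ * planeArea u₁ u₂ / S ^ 2 := by
  simp only [coordMatrix, Matrix.det_fin_two_of, planeArea]
  ring

theorem shear_add_smul (s : ℝ) (p u v : ℂ) (a b : ℝ) :
    shear s p (a * u + b * v) = a * shear s p u + b * shear s p v := by
  simp [shear]
  ring

theorem eq_planeArea_combination {c₁ c₂ : ℂ} {S : ℝ} (hS : S ≠ 0) (h : planeArea c₁ c₂ = S)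
    (u : ℂ) : u = ((planeArea u c₂ / S : ℝ) : ℂ) * c₁ + ((planeArea c₁ u / S : ℝ) : ℂ) * c₂ := by
  simp only [planeArea] at h ⊢
  apply Complex.ext
  · simp only [Complex.add_re, Complex.mul_re, Complex.ofReal_re, Complex.ofReal_im]
    field_simp
    linear_combination (-u.re) * h
  · simp only [Complex.add_im, Complex.mul_im, Complex.ofReal_re, Complex.ofReal_im]
    field_simp
    linear_combination (-u.im) * h

/-- Passing to frame coordinates is real linear on $\mathbb{C}$, hence of the form $c\mapsto
Pc+P'\bar c$. In this form orientation is the inequality $|P'|<|P|$, and the winding is governed by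
$P$ alone. -/
theorem coordMatrix_mulVec (S : ℝ) (c₁ c₂ u₁ u₂ : ℂ) (a b : ℝ) :
    vecToComplex ((coordMatrix S c₁ c₂ u₁ u₂).mulVec ![a, b]) =
      ((starRingEnd ℂ) (c₁ - Complex.I * c₂) * (a * u₁ + b * u₂) -
        (c₁ + Complex.I * c₂) * (starRingEnd ℂ) (a * u₁ + b * u₂)) / (2 * S : ℝ) := by
  apply Complex.ext
  · rw [Complex.div_ofReal_re]
    simp [vecToComplex, coordMatrix, planeArea, Matrix.mulVec, dotProduct, Fin.sum_univ_two]
    field_simp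
    ring
  · rw [Complex.div_ofReal_im]
    simp [vecToComplex, coordMatrix, planeArea, Matrix.mulVec, dotProduct, Fin.sum_univ_two]
    field_simp
    ring

/-! ### Logarithms along the orbits of the torus -/

theorem continuous_torusAct_curve :
    Continuous fun p : ℝ × ℝ × ℝ =>
      torusAct p.2.1 p.2.2 ((Real.cos p.1 : ℂ), (Real.sin p.1 : ℂ)) := by
  unfold torusAct
  fun_prop

theorem torusAct_ne_zero {a b : ℝ} {z : ℂ × ℂ} (hz : z ≠ 0) : torusAct a b z ≠ 0 := by
  intro h
  have h1 := sqNorm_torusAct a b z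
  rw [h, sqNorm_zero] at h1
  exact (sqNorm_pos hz).ne h1

theorem cos_sin_ne_zero (s : ℝ) : ((Real.cos s : ℂ), (Real.sin s : ℂ)) ≠ (0 : ℂ × ℂ) := by
  intro h
  have h1 : Real.cos s = 0 := Complex.ofReal_eq_zero.1 (Prod.ext_iff.1 h).1
  have h2 : Real.sin s = 0 := Complex.ofReal_eq_zero.1 (Prod.ext_iff.1 h).2
  have := Real.cos_sq_add_sin_sq s
  simp [h1, h2] at this

theorem torusAct_torusAct (a b a' b' : ℝ) (z : ℂ × ℂ) :
    torusAct a b (torusAct a' b' z) = torusAct (a + a') (b + b') z := by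
  simp only [torusAct, ← mul_assoc, ← Complex.exp_add]
  push_cast
  ring_nf

theorem exists_polar {z : ℂ × ℂ} (hz : z ≠ 0) : ∃ R : ℝ, 0 < R ∧ ∃ s a b : ℝ,
    z = R • torusAct a b ((Real.cos s : ℂ), (Real.sin s : ℂ)) := by
  set w : ℂ := ⟨‖z.1‖, ‖z.2‖⟩ with hw
  have hw0 : w ≠ 0 := fun h => hz <| Prod.ext (norm_eq_zero.1 (Complex.ext_iff.1 h).1)
    (norm_eq_zero.1 (Complex.ext_iff.1 h).2)
  refine ⟨‖w‖, norm_pos_iff.2 hw0, w.arg, z.1.arg, z.2.arg, ?_⟩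
  have h1 : ‖w‖ * Real.cos w.arg = ‖z.1‖ := Complex.norm_mul_cos_arg w
  have h2 : ‖w‖ * Real.sin w.arg = ‖z.2‖ := Complex.norm_mul_sin_arg w
  have e1 := Complex.norm_mul_exp_arg_mul_I z.1
  have e2 := Complex.norm_mul_exp_arg_mul_I z.2
  rw [← h1] at e1
  rw [← h2] at e2
  push_cast at e1 e2
  ext1
  · simp only [torusAct, Prod.smul_fst, Complex.real_smul]
    push_cast
    linear_combination -e1
  · simp only [torusAct, Prod.smul_snd, Complex.real_smul]
    push_cast
    linear_combination -e2

/-- A continuous function periodic in two real variables is bounded. -/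
theorem exists_bound_of_periodic {E : Type*} [SeminormedAddGroup E] {L : ℝ × ℝ → E}
    (hL : Continuous L) {T : ℝ} (hT : 0 < T) (h1 : ∀ a b, L (a + T, b) = L (a, b))
    (h2 : ∀ a b, L (a, b + T) = L (a, b)) : ∃ C, ∀ p, ‖L p‖ ≤ C := by
  obtain ⟨C, hC⟩ := (isCompact_Icc.prod isCompact_Icc).exists_bound_of_continuousOn
    (s := Icc (0 : ℝ) T ×ˢ Icc (0 : ℝ) T) hL.continuousOn
  refine ⟨C, fun p => ?_⟩
  have p1 : Function.Periodic (fun a => L (a, p.2)) T := fun a => h1 a p.2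
  obtain ⟨a', ha', ea⟩ := p1.exists_mem_Ico₀ hT p.1
  have p2 : Function.Periodic (fun b => L (a', b)) T := fun b => h2 a' b
  obtain ⟨b', hb', eb⟩ := p2.exists_mem_Ico₀ hT p.2
  have : L p = L (a', b') := ea.trans eb
  rw [this]
  exact hC _ ⟨Ico_subset_Icc_self ha', Ico_subset_Icc_self hb'⟩

/-- A continuous nonvanishing function on `level q` has a bounded logarithm along each orbit of the
torus: the orbits are contracted in `level q` to points of the axes. -/
theorem exists_bounded_log {q : ℝ → ℝ} (hq : ContDiff ℝ ∞ q) (hpos : ∀ t, 0 < q t)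
    {P : ℂ × ℂ → ℂ} (hP : ContinuousOn P (level q)) (hP0 : ∀ z ∈ level q, P z ≠ 0) {y : ℂ × ℂ}
    (hy : y ∈ level q) : ∃ L : ℝ × ℝ → ℂ, Continuous L ∧
      (∀ a b, Complex.exp (L (a, b)) = P (torusAct a b y)) ∧ ∃ C, ∀ p, ‖L p‖ ≤ C := by
  -- These coordinates cover the unit sphere by the simply connected $\mathbb{R}^3$, so a logarithm
  -- exists upstairs; its periodicity in the two angles has to be proved.
  set A : ℝ × ℝ × ℝ → ℂ × ℂ := fun p =>
    torusAct p.2.1 p.2.2 ((Real.cos p.1 : ℂ), (Real.sin p.1 : ℂ)) with hA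
  have hA0 : ∀ p, A p ≠ 0 := fun p => torusAct_ne_zero (cos_sin_ne_zero _)
  have hAm : ∀ p, retract q (A p) ∈ level q := fun p => retract_mem_level hpos (hA0 p)
  have hAc : Continuous fun p => retract q (A p) := continuous_iff_continuousAt.2 fun p =>
    ((contDiffAt_retract hq hpos (hA0 p)).continuousAt).comp
      (f := A) continuous_torusAct_curve.continuousAt
  set G : ℝ × ℝ × ℝ → ℂ := fun p => P (retract q (A p)) with hG
  have hGc : Continuous G := hP.comp_continuous hAc hAm
  obtain ⟨L, hLc, hL⟩ := exists_continuous_log hGc fun p => hP0 _ (hAm p)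
  have hG0 : ∀ p, G p ≠ 0 := fun p => hP0 _ (hAm p)
  have e2 : Complex.exp (((2 * Real.pi : ℝ) : ℂ) * Complex.I) = 1 := by
    push_cast
    exact Complex.exp_two_pi_mul_I
  -- The increment over a period of `a` is the same at all points. At `s = π/2` the first coordinate
  -- vanishes, so nothing depends on `a` and the increment is zero. The same argument at `s = 0`
  -- serves for `b`.
  have per1 : ∀ s a b, L (s, a + 2 * Real.pi, b) = L (s, a, b) := fun s a b => by
    have h1 := eq_of_exp_eq_one
      (h := fun p : ℝ × ℝ × ℝ => L (p.1, p.2.1 + 2 * Real.pi, p.2.2) - L p) (by fun_prop)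
      (fun p => by
        have : G (p.1, p.2.1 + 2 * Real.pi, p.2.2) = G p := by
          simp only [hG, hA, torusAct]
          rw [Complex.ofReal_add, add_mul, Complex.exp_add, e2, mul_one]
        rw [Complex.exp_sub, hL, hL, this, div_self (hG0 _)]) (s, a, b) (Real.pi / 2, 0, 0)
    have h2 := eq_of_exp_eq_one
      (h := fun a : ℝ => L (Real.pi / 2, a, 0) - L (Real.pi / 2, 0, 0)) (by fun_prop)
      (fun a => by
        have : G (Real.pi / 2, a, 0) = G (Real.pi / 2, 0, 0) := by
          simp [hG, hA, torusAct]
        rw [Complex.exp_sub, hL, hL, this, div_self (hG0 _)]) (0 + 2 * Real.pi) 0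
    simp only [sub_self] at h1 h2
    exact sub_eq_zero.1 (h1.trans h2)
  have per2 : ∀ s a b, L (s, a, b + 2 * Real.pi) = L (s, a, b) := fun s a b => by
    have h1 := eq_of_exp_eq_one
      (h := fun p : ℝ × ℝ × ℝ => L (p.1, p.2.1, p.2.2 + 2 * Real.pi) - L p) (by fun_prop)
      (fun p => by
        have : G (p.1, p.2.1, p.2.2 + 2 * Real.pi) = G p := by
          simp only [hG, hA, torusAct]
          rw [Complex.ofReal_add p.2.2, add_mul (p.2.2 : ℂ), Complex.exp_add, e2, mul_one]
        rw [Complex.exp_sub, hL, hL, this, div_self (hG0 _)]) (s, a, b) (0, 0, 0)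
    have h2 := eq_of_exp_eq_one
      (h := fun b : ℝ => L (0, 0, b) - L (0, 0, 0)) (by fun_prop)
      (fun b => by
        have : G (0, 0, b) = G (0, 0, 0) := by
          simp [hG, hA, torusAct]
        rw [Complex.exp_sub, hL, hL, this, div_self (hG0 _)]) (0 + 2 * Real.pi) 0
    simp only [sub_self] at h1 h2
    exact sub_eq_zero.1 (h1.trans h2)
  obtain ⟨R, hR, s, a₀, b₀, hyR⟩ := exists_polar (ne_zero_of_mem_level hy)
  refine ⟨fun p => L (s, p.1 + a₀, p.2 + b₀), by fun_prop, fun a b => ?_, ?_⟩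
  · rw [hL]
    simp only [hG, hA]
    rw [← torusAct_torusAct, retract_torusAct]
    congr 2
    rw [← retract_smul q hR, ← hyR, retract_of_mem hy]
  · refine exists_bound_of_periodic (T := 2 * Real.pi) (by fun_prop) (by positivity)
      (fun a b => ?_) (fun a b => ?_)
    · simp only [← per1 s (a + a₀) (b + b₀)]
      ring_nf
    · simp only [← per2 s (a + a₀) (b + b₀)]
      ring_nf

/-! ### The mean rotation of the Reeb flow -/

/-- The shear is driven by the scalar product with $p$ and moves along $ip$, which is orthogonal to
$p$. Following this fixed vector removes $q''$ from the rotation number. -/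
theorem exists_shear_fixed (p : ℂ) : ∃ c : ℂ, c ≠ 0 ∧ ∀ a, shear a p c = c := by
  by_cases hp : p = 0
  · exact ⟨1, one_ne_zero, fun a => by simp [shear, hp]⟩
  · refine ⟨Complex.I * p, mul_ne_zero Complex.I_ne_zero hp, fun a => ?_⟩
    have : (Complex.I * p).re * p.re + (Complex.I * p).im * p.im = 0 := by
      simp
      ring
    rw [shear, this]
    simp

/-- The angle of the image of a rotating vector under a bounded path of orientation preserving
linear maps `c ↦ P c + P' conj c`. -/
theorem exists_log_rotating {P P' : ℝ → ℂ} {ℓ : ℝ → ℂ} (hℓ : Continuous ℓ)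
    (hP' : Continuous P') (hexp : ∀ t, Complex.exp (ℓ t) = P t) {C : ℝ} (hC : ∀ t, ‖ℓ t‖ ≤ C)
    (hlt : ∀ t, ‖P' t‖ < ‖P t‖) {c : ℂ} (hc : c ≠ 0) (γ : ℝ) {S : ℝ} (hS : 0 < S) :
    ∃ l : ℝ → ℂ, Continuous l ∧ (∀ t, Complex.exp (l t) =
      (P t * (Complex.exp ((γ * t : ℝ) * Complex.I) * c) +
        P' t * (starRingEnd ℂ) (Complex.exp ((γ * t : ℝ) * Complex.I) * c)) / S) ∧
      ∃ C', ∀ t, |(l t).im - γ * t| ≤ C' := by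
  have hPc : Continuous P := by
    have : P = fun t => Complex.exp (ℓ t) := funext fun t => (hexp t).symm
    rw [this]
    fun_prop
  have hP0 : ∀ t, P t ≠ 0 := fun t => by
    rw [← hexp]
    exact Complex.exp_ne_zero _
  set u : ℝ → ℂ := fun t => Complex.exp ((γ * t : ℝ) * Complex.I) * c with hu
  have huc : Continuous u := by
    simp only [hu]
    fun_prop
  have hu0 : ∀ t, u t ≠ 0 := fun t => mul_ne_zero (Complex.exp_ne_zero _) hc
  -- The sum factors as $Pu(1+w)$ with $|w|<1$, so the principal logarithm of $1+w$ is continuous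
  -- and its argument is bounded.
  set w : ℝ → ℂ := fun t => P' t * (starRingEnd ℂ) (u t) / (P t * u t) with hw
  have hwc : Continuous w := by
    refine (hP'.mul (Complex.continuous_conj.comp huc)).div (hPc.mul huc) fun t => ?_
    exact mul_ne_zero (hP0 t) (hu0 t)
  have hw1 : ∀ t, ‖w t‖ < 1 := fun t => by
    simp only [hw, norm_div, norm_mul, Complex.norm_conj]
    rw [div_lt_one (mul_pos (norm_pos_iff.2 (hP0 t)) (norm_pos_iff.2 (hu0 t)))]
    exact mul_lt_mul_of_pos_right (hlt t) (norm_pos_iff.2 (hu0 t))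
  have hslit : ∀ t, 1 + w t ∈ Complex.slitPlane := fun t =>
    Complex.mem_slitPlane_of_norm_lt_one (hw1 t)
  refine ⟨fun t => ℓ t + (γ * t : ℝ) * Complex.I + Complex.log c + Complex.log (1 + w t) -
    Complex.log S, ?_, fun t => ?_, C + 3 * Real.pi, fun t => ?_⟩
  · have : Continuous fun t => Complex.log (1 + w t) :=
      (continuous_const.add hwc).clog hslit
    fun_prop
  · rw [Complex.exp_sub, Complex.exp_add, Complex.exp_add, Complex.exp_add, hexp,
      Complex.exp_log hc, Complex.exp_log (Complex.slitPlane_ne_zero (hslit t)),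
      Complex.exp_log (by exact_mod_cast hS.ne')]
    change _ = (P t * u t + P' t * (starRingEnd ℂ) (u t)) / S
    have h1 : P t * u t + P' t * (starRingEnd ℂ) (u t) = P t * u t * (1 + w t) := by
      simp only [hw]
      rw [mul_add, mul_one, mul_div_cancel₀ _ (mul_ne_zero (hP0 t) (hu0 t))]
    rw [h1]
    simp only [hu]
    ring
  · have h1 := (Complex.abs_im_le_norm (ℓ t)).trans (hC t)
    have h2 := Complex.abs_arg_le_pi c
    have h3 := Complex.abs_arg_le_pi (1 + w t)
    have h4 : (Complex.log (S : ℂ)).im = 0 := by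
      rw [Complex.log_im]
      exact Complex.arg_ofReal_of_nonneg hS.le
    have h5 : ((γ * t : ℝ) * Complex.I).im = γ * t := by simp
    simp only [Complex.sub_im, Complex.add_im, h4, h5, Complex.log_im]
    rw [abs_le] at h1 h2 h3 ⊢
    constructor <;> linarith [Real.pi_pos]

theorem continuous_coordMatrix {c₁ c₂ u₁ u₂ : ℝ → ℂ} (S : ℝ) (h₁ : Continuous c₁)
    (h₂ : Continuous c₂) (k₁ : Continuous u₁) (k₂ : Continuous u₂) :
    Continuous fun t => coordMatrix S (c₁ t) (c₂ t) (u₁ t) (u₂ t) := by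
  refine continuous_matrix fun i j => ?_
  fin_cases i <;> fin_cases j <;>
  · simp [coordMatrix, planeArea]
    fun_prop

theorem hasMeanRotation_linearizedFlow {q : ℝ → ℝ} (hq : ContDiff ℝ ∞ q) (hpos : ∀ t, 0 < q t)
    {φ : ℝ → ℂ × ℂ → ℂ × ℂ} (hφ : IsReebFlow (level q) φ) {e₁ e₂ : ℂ × ℂ → ℂ × ℂ}
    (he : IsSymplecticFrame (level q) e₁ e₂) {y : ℂ × ℂ} (hy : y ∈ level q) :
    HasMeanRotation (linearizedFlow (level q) φ e₁ e₂ y)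
      (freqOne q (ratio y) + freqTwo q (ratio y)) := by
  have hy0 := ne_zero_of_mem_level hy
  have hS := sqNorm_pos hy0
  have hΦ := linearizedFlow_eq hq hpos hφ he hy
  have hplane := fun z (hz : z ∈ level q) => he.planeArea_eq hz
  obtain ⟨C₁, hC₁⟩ : ∃ C₁ : ℂ × ℂ → ℂ, ∀ z, crossDet z (e₁ z) = C₁ z := ⟨_, fun _ => rfl⟩
  obtain ⟨C₂, hC₂⟩ : ∃ C₂ : ℂ × ℂ → ℂ, ∀ z, crossDet z (e₂ z) = C₂ z := ⟨_, fun _ => rfl⟩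
  have hC₁c : ContinuousOn C₁ (level q) := by
    have := he.continuousOn_fst
    refine ContinuousOn.congr (f := fun z => crossDet z (e₁ z)) ?_ fun z _ => (hC₁ z).symm
    simp only [crossDet]
    fun_prop
  have hC₂c : ContinuousOn C₂ (level q) := by
    have := he.continuousOn_snd
    refine ContinuousOn.congr (f := fun z => crossDet z (e₂ z)) ?_ fun z _ => (hC₂ z).symm
    simp only [crossDet]
    fun_prop
  simp only [hC₁, hC₂] at hΦ hplane
  have hmem : ∀ t, toricFlow q t y ∈ level q := fun t =>
    ((isReebFlow_toricFlow hq hpos y hy).2 t).1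
  have hflow : Continuous fun t => toricFlow q t y := by
    unfold toricFlow torusAct
    fun_prop
  have hc1 : Continuous fun t => C₁ (toricFlow q t y) := hC₁c.comp_continuous hflow hmem
  have hc2 : Continuous fun t => C₂ (toricFlow q t y) := hC₂c.comp_continuous hflow hmem
  have harea : ∀ t, planeArea (C₁ (toricFlow q t y)) (C₂ (toricFlow q t y)) = sqNorm y := fun t => by
    rw [hplane _ (hmem t), toricFlow, sqNorm_torusAct]
  have hflow0 : toricFlow q 0 y = y := (isReebFlow_toricFlow hq hpos y hy).1
  have harea0 : planeArea (C₁ y) (C₂ y) = sqNorm y := hplane y hy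
  -- The vector to follow; `a` and `b` are its coordinates in the frame at `y`.
  obtain ⟨c, hc0, hc⟩ := exists_shear_fixed (y.1 * y.2)
  have hcomb := eq_planeArea_combination hS.ne' harea0 c
  set a : ℝ := planeArea c (C₂ y) / sqNorm y
  set b : ℝ := planeArea (C₁ y) c / sqNorm y
  -- The difference of the two squared norms is four times the area spanned by the frame, which is
  -- positive.
  have hnorm : ∀ z ∈ level q,
      ‖-(C₁ z + Complex.I * C₂ z)‖ < ‖(starRingEnd ℂ) (C₁ z - Complex.I * C₂ z)‖ := fun z hz => by
    have h1 : planeArea (C₁ z) (C₂ z) = sqNorm z := hplane z hz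
    have h2 := sqNorm_pos (ne_zero_of_mem_level hz)
    rw [norm_neg, Complex.norm_conj]
    refine lt_of_pow_lt_pow_left₀ 2 (norm_nonneg _) ?_
    rw [← Complex.normSq_eq_norm_sq, ← Complex.normSq_eq_norm_sq, Complex.normSq_apply,
      Complex.normSq_apply]
    simp only [planeArea] at h1
    simp
    nlinarith
  -- The coefficient $P$ is defined and nonzero on the whole hypersurface, so its argument stays
  -- bounded along the torus orbit, which contains the Reeb orbit.
  obtain ⟨L, hLc, hL, K, hK⟩ := exists_bounded_log hq hpos
    (P := fun z => (starRingEnd ℂ) (C₁ z - Complex.I * C₂ z))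
    (Complex.continuous_conj.comp_continuousOn (hC₁c.sub (continuousOn_const.mul hC₂c)))
    (fun z hz => norm_pos_iff.1 ((norm_nonneg _).trans_lt (hnorm z hz))) hy
  obtain ⟨l, hlc, hl, K', hK'⟩ := exists_log_rotating
    (P := fun t => (starRingEnd ℂ) (C₁ (toricFlow q t y) - Complex.I * C₂ (toricFlow q t y)))
    (P' := fun t => -(C₁ (toricFlow q t y) + Complex.I * C₂ (toricFlow q t y)))
    (ℓ := fun t => L (2 * Real.pi * freqOne q (ratio y) * t, 2 * Real.pi * freqTwo q (ratio y) * t))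
    (by fun_prop) (hc1.add (continuous_const.mul hc2)).neg (fun t => hL _ _) (fun t => hK _) (fun t => hnorm _ (hmem t)) hc0
    (totalFreq q y) (S := 2 * sqNorm y) (by positivity)
  refine hasMeanRotation_of_angle (u := ![a, b]) (θ := fun t => (l t).im / (2 * Real.pi))
    (Continuous.continuousOn ?_) ?_ (fun t _ => ?_) (Continuous.continuousOn (by fun_prop))
    (fun t _ => ⟨_, Real.exp_pos _, eq_smul_unitVec_of_exp ?_⟩) ?_
  · have : linearizedFlow (level q) φ e₁ e₂ y = _ := funext hΦ
    rw [this]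
    refine continuous_coordMatrix _ hc1 hc2 ?_ ?_ <;>
    · simp only [shear]
      fun_prop
  · rw [hΦ, hflow0]
    simp only [mul_zero, Complex.ofReal_zero, zero_mul, Complex.exp_zero, one_mul, shear, add_zero]
    have h1 : planeArea (C₁ y) (C₁ y) = 0 := by simp [planeArea, mul_comm]
    have h2 : planeArea (C₂ y) (C₂ y) = 0 := by simp [planeArea, mul_comm]
    rw [coordMatrix, h1, h2, harea0, div_self hS.ne', zero_div, Matrix.one_fin_two]
  · rw [hΦ, det_coordMatrix, planeArea_exp_mul, planeArea_shear, harea, harea0]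
    exact div_ne_zero (mul_ne_zero hS.ne' hS.ne') (pow_ne_zero 2 hS.ne')
  · rw [hl, hΦ, coordMatrix_mulVec]
    have : (a : ℂ) * (Complex.exp ((totalFreq q y * t : ℝ) * Complex.I) *
          shear (shearRate q y * t) (y.1 * y.2) (C₁ y)) +
        b * (Complex.exp ((totalFreq q y * t : ℝ) * Complex.I) *
          shear (shearRate q y * t) (y.1 * y.2) (C₂ y)) =
        Complex.exp ((totalFreq q y * t : ℝ) * Complex.I) * c := by
      rw [← hc (shearRate q y * t)]
      conv_rhs => rw [hcomb, shear_add_smul]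
      ring
    rw [this]
    ring
  · have hpi : (2 * Real.pi : ℝ) ≠ 0 := by positivity
    have h0 : Tendsto (fun t => ((l t).im - totalFreq q y * t) / (2 * Real.pi) / t) atTop (𝓝 0) := by
      refine squeeze_zero_norm' (a := fun t => K' / (2 * Real.pi) / t) ?_
        (tendsto_const_nhds.div_atTop tendsto_id)
      filter_upwards [eventually_gt_atTop 0] with t ht
      rw [norm_div, norm_div, Real.norm_of_nonneg ht.le,
        Real.norm_of_nonneg (show 0 ≤ 2 * Real.pi by positivity), Real.norm_eq_abs]
      exact div_le_div_of_nonneg_right (div_le_div_of_nonneg_right (hK' t) (by positivity)) ht.le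
    have h1 := h0.add_const (freqOne q (ratio y) + freqTwo q (ratio y))
    rw [zero_add] at h1
    refine h1.congr' ?_
    filter_upwards [eventually_gt_atTop 0] with t ht
    rw [totalFreq]
    field_simp
    ring

theorem isRotationFunction_level {q : ℝ → ℝ} (hq : ContDiff ℝ ∞ q) (hpos : ∀ t, 0 < q t) :
    IsRotationFunction (level q) (fun z => freqOne q (ratio z) + freqTwo q (ratio z)) :=
  ⟨⟨_, isReebFlow_toricFlow hq hpos⟩, ⟨_, _, isSymplecticFrame_frameProj hq hpos⟩,
    fun _ _ _ hφ he _ hy => hasMeanRotation_linearizedFlow hq hpos hφ he hy⟩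

/-! ### Linear coordinates on `ℂ²` -/

/-- The last three real coordinates of `ℂ²`. -/
def tailCoord : ℂ × ℂ →L[ℝ] (Fin 3 → ℝ) :=
  ContinuousLinearMap.pi ![Complex.imCLM.comp (ContinuousLinearMap.fst ℝ ℂ ℂ),
    Complex.reCLM.comp (ContinuousLinearMap.snd ℝ ℂ ℂ),
    Complex.imCLM.comp (ContinuousLinearMap.snd ℝ ℂ ℂ)]

theorem tailCoord_apply (p : ℂ × ℂ) : tailCoord p = ![p.1.im, p.2.re, p.2.im] := by
  ext i
  fin_cases i <;> simp [tailCoord]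

theorem measurePreserving_finThree :
    MeasurePreserving (fun p : ℝ × ℝ × ℝ => (![p.1, p.2.1, p.2.2] : Fin 3 → ℝ)) volume volume := by
  have h1 := (volume_preserving_piFinSuccAbove (fun _ : Fin 3 => ℝ) 0).symm
  have h2 := (MeasurePreserving.id (volume : Measure ℝ)).prod (volume_preserving_finTwoArrow ℝ).symm
  have h3 : (fun p : ℝ × ℝ × ℝ => (![p.1, p.2.1, p.2.2] : Fin 3 → ℝ)) =
      (MeasurableEquiv.piFinSuccAbove (fun _ : Fin 3 => ℝ) 0).symm ∘
        Prod.map id MeasurableEquiv.finTwoArrow.symm := by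
    funext p
    ext i
    fin_cases i <;> rfl
  rw [h3]
  exact h1.comp h2

theorem measurePreserving_coord :
    MeasurePreserving (fun p : ℂ × ℂ => (p.1.re, tailCoord p)) volume volume := by
  have h1 := Complex.volume_preserving_equiv_real_prod.prod Complex.volume_preserving_equiv_real_prod
  have h2 := (volume_preserving_prodAssoc (α₁ := ℝ) (β₁ := ℝ) (γ₁ := ℝ × ℝ))
  have h3 := (MeasurePreserving.id (volume : Measure ℝ)).prod measurePreserving_finThree
  have h4 := h3.comp (h2.comp h1)
  have h5 : (fun p : ℂ × ℂ => (p.1.re, tailCoord p)) =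
      (Prod.map id fun p : ℝ × ℝ × ℝ => (![p.1, p.2.1, p.2.2] : Fin 3 → ℝ)) ∘
        MeasurableEquiv.prodAssoc ∘
          Prod.map Complex.measurableEquivRealProd Complex.measurableEquivRealProd := by
    funext p
    rw [tailCoord_apply]
    rfl
  rw [h5]
  exact h4

theorem measurableEmbedding_coord :
    MeasurableEmbedding (fun p : ℂ × ℂ => (p.1.re, tailCoord p)) := by
  refine Continuous.measurableEmbedding (by fun_prop) fun p p' h => ?_
  simp only [tailCoord_apply, Prod.mk.injEq] at h
  have h1 := congrFun h.2 0
  have h2 := congrFun h.2 1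
  have h3 := congrFun h.2 2
  simp at h1 h2 h3
  exact Prod.ext (Complex.ext h.1 h1) (Complex.ext h2 h3)

/-- The determinant of an endomorphism of `ℂ²` through the square of the symplectic form. -/
theorem det_eq_stdOmega (L : ℂ × ℂ →ₗ[ℝ] ℂ × ℂ) :
    LinearMap.det L = stdOmega (L (1, 0)) (L (Complex.I, 0)) * stdOmega (L (0, 1)) (L (0, Complex.I))
      - stdOmega (L (1, 0)) (L (0, 1)) * stdOmega (L (Complex.I, 0)) (L (0, Complex.I))
      + stdOmega (L (1, 0)) (L (0, Complex.I)) * stdOmega (L (Complex.I, 0)) (L (0, 1)) := by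
  let b := (Complex.basisOneI.prod Complex.basisOneI).reindex finSumFinEquiv
  have b0 : b 0 = (1, 0) := by
    have : (finSumFinEquiv (m := 2) (n := 2)).symm 0 = Sum.inl 0 := rfl
    simp [b, this]
  have b1 : b 1 = (Complex.I, 0) := by
    have : (finSumFinEquiv (m := 2) (n := 2)).symm 1 = Sum.inl 1 := rfl
    simp [b, this]
  have b2 : b 2 = (0, 1) := by
    have : (finSumFinEquiv (m := 2) (n := 2)).symm 2 = Sum.inr 0 := rfl
    simp [b, this]
  have b3 : b 3 = (0, Complex.I) := by
    have : (finSumFinEquiv (m := 2) (n := 2)).symm 3 = Sum.inr 1 := rfl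
    simp [b, this]
  have r0 : ∀ v, b.repr v 0 = v.1.re := fun v => by
    have : (finSumFinEquiv (m := 2) (n := 2)).symm 0 = Sum.inl 0 := rfl
    simp [b, this]
  have r1 : ∀ v, b.repr v 1 = v.1.im := fun v => by
    have : (finSumFinEquiv (m := 2) (n := 2)).symm 1 = Sum.inl 1 := rfl
    simp [b, this]
  have r2 : ∀ v, b.repr v 2 = v.2.re := fun v => by
    have : (finSumFinEquiv (m := 2) (n := 2)).symm 2 = Sum.inr 0 := rfl
    simp [b, this]
  have r3 : ∀ v, b.repr v 3 = v.2.im := fun v => by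
    have : (finSumFinEquiv (m := 2) (n := 2)).symm 3 = Sum.inr 1 := rfl
    simp [b, this]
  have hM : LinearMap.toMatrix b b L = !![
      (L (1, 0)).1.re, (L (Complex.I, 0)).1.re, (L (0, 1)).1.re, (L (0, Complex.I)).1.re;
      (L (1, 0)).1.im, (L (Complex.I, 0)).1.im, (L (0, 1)).1.im, (L (0, Complex.I)).1.im;
      (L (1, 0)).2.re, (L (Complex.I, 0)).2.re, (L (0, 1)).2.re, (L (0, Complex.I)).2.re;
      (L (1, 0)).2.im, (L (Complex.I, 0)).2.im, (L (0, 1)).2.im, (L (0, Complex.I)).2.im] := by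
    ext i j
    rw [LinearMap.toMatrix_apply]
    fin_cases i <;> fin_cases j <;> simp [b0, b1, b2, b3, r0, r1, r2, r3]
  rw [← LinearMap.det_toMatrix b, hM]
  simp [Matrix.det_succ_row_zero, Fin.sum_univ_succ, Fin.succAbove, stdOmega]
  ring

/-! ### The contact volume as a cone measure -/

/-- The cone over `level q`: the sublevel set of `ham q` without the origin. -/
def solidCone (q : ℝ → ℝ) : Set (ℂ × ℂ) := {z | z ≠ 0 ∧ ham q z ≤ 1}

/-- The cone measure of `level q`. -/
def coneMeasure (q : ℝ → ℝ) : Measure (ℂ × ℂ) :=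
  (2 : ENNReal) • (volume.restrict (solidCone q)).map (retract q)

theorem measurable_ratio : Measurable ratio :=
  (Complex.continuous_normSq.measurable.comp measurable_snd).div continuous_sqNorm.measurable

theorem measurable_ham {q : ℝ → ℝ} (hq : Continuous q) : Measurable (ham q) :=
  (continuous_sqNorm.measurable.const_mul _).mul (hq.measurable.comp measurable_ratio)

theorem measurable_retract {q : ℝ → ℝ} (hq : Continuous q) : Measurable (retract q) :=
  (measurable_ham hq).sqrt.inv.smul measurable_id

theorem measurableSet_level {q : ℝ → ℝ} (hq : Continuous q) : MeasurableSet (level q) :=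
  measurable_ham hq (measurableSet_singleton 1)

theorem measurableSet_solidCone {q : ℝ → ℝ} (hq : Continuous q) : MeasurableSet (solidCone q) :=
  (measurableSet_singleton 0).compl.inter (measurable_ham hq measurableSet_Iic)

theorem coneMeasure_apply {q : ℝ → ℝ} (hq : Continuous q) {B : Set (ℂ × ℂ)} (hB : MeasurableSet B) :
    coneMeasure q B = 2 * volume (retract q ⁻¹' B ∩ solidCone q) := by
  rw [coneMeasure, Measure.smul_apply, Measure.map_apply (measurable_retract hq) hB,
    Measure.restrict_apply (measurable_retract hq hB), smul_eq_mul]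

theorem coneMeasure_compl_level {q : ℝ → ℝ} (hq : Continuous q) (hpos : ∀ t, 0 < q t) :
    coneMeasure q (level q)ᶜ = 0 := by
  rw [coneMeasure_apply hq (measurableSet_level hq).compl]
  have : retract q ⁻¹' (level q)ᶜ ∩ solidCone q = ∅ := by
    ext z
    simp only [mem_inter_iff, mem_preimage, mem_compl_iff, mem_empty_iff_false, iff_false, not_and]
    exact fun h hz => h (retract_mem_level hpos hz.1)
  rw [this, measure_empty, mul_zero]

/-- The cone over a parametrized hypersurface. -/
def coneMap (ψ : (Fin 3 → ℝ) → ℂ × ℂ) (p : ℂ × ℂ) : ℂ × ℂ := p.1.re • ψ (tailCoord p)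

/-- The derivative of `coneMap`. -/
def coneDeriv (ψ : (Fin 3 → ℝ) → ℂ × ℂ) (p : ℂ × ℂ) : ℂ × ℂ →L[ℝ] ℂ × ℂ :=
  p.1.re • (fderiv ℝ ψ (tailCoord p)).comp tailCoord +
    (Complex.reCLM.comp (ContinuousLinearMap.fst ℝ ℂ ℂ)).smulRight (ψ (tailCoord p))

theorem hasFDerivAt_coneMap {ψ : (Fin 3 → ℝ) → ℂ × ℂ} {p : ℂ × ℂ}
    (h : DifferentiableAt ℝ ψ (tailCoord p)) : HasFDerivAt (coneMap ψ) (coneDeriv ψ p) p := by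
  have h1 := (Complex.reCLM.comp (ContinuousLinearMap.fst ℝ ℂ ℂ)).hasFDerivAt (x := p)
  exact h1.smul (h.hasFDerivAt.comp p tailCoord.hasFDerivAt)

/-- The density of `λ ∧ dλ` in a parametrization. -/
def chartDensity (ψ : (Fin 3 → ℝ) → ℂ × ℂ) (u : Fin 3 → ℝ) : ℝ :=
  contactForm3 (ψ u) (fderiv ℝ ψ u (Pi.single 0 1)) (fderiv ℝ ψ u (Pi.single 1 1))
    (fderiv ℝ ψ u (Pi.single 2 1))

/-- The columns are $\psi$ and $r\,\partial_i\psi$. Euclidean volume is $\frac12\omega\wedge\omega$,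
and contracting it with the radial vector gives $2\lambda\wedge\omega$. -/
theorem det_coneDeriv (ψ : (Fin 3 → ℝ) → ℂ × ℂ) (p : ℂ × ℂ) :
    (coneDeriv ψ p).det = 2 * p.1.re ^ 3 * chartDensity ψ (tailCoord p) := by
  have t0 : tailCoord (1, 0) = 0 := by
    rw [tailCoord_apply]
    ext i
    fin_cases i <;> simp
  have t1 : tailCoord (Complex.I, 0) = Pi.single 0 1 := by
    rw [tailCoord_apply]
    ext i
    fin_cases i <;> simp
  have t2 : tailCoord (0, 1) = Pi.single 1 1 := by
    rw [tailCoord_apply]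
    ext i
    fin_cases i <;> simp
  have t3 : tailCoord (0, Complex.I) = Pi.single 2 1 := by
    rw [tailCoord_apply]
    ext i
    fin_cases i <;> simp
  rw [ContinuousLinearMap.det, det_eq_stdOmega]
  simp only [ContinuousLinearMap.coe_coe, coneDeriv, add_apply, smul_apply,
    ContinuousLinearMap.comp_apply, ContinuousLinearMap.smulRight_apply, t0, t1, t2, t3, map_zero,
    smul_zero, zero_add, ContinuousLinearMap.coe_fst', Complex.reCLM_apply, Complex.one_re, one_smul,
    Complex.I_re, zero_smul, add_zero, chartDensity]
  generalize fderiv ℝ ψ (tailCoord p) (Pi.single 0 1) = u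
  generalize fderiv ℝ ψ (tailCoord p) (Pi.single 1 1) = v
  generalize fderiv ℝ ψ (tailCoord p) (Pi.single 2 1) = w
  generalize ψ (tailCoord p) = z
  simp [stdOmega, contactForm3, stdLambda]
  ring

theorem retract_preimage_inter_solidCone {q : ℝ → ℝ} (hpos : ∀ t, 0 < q t)
    {ψ : (Fin 3 → ℝ) → ℂ × ℂ} {A : Set (Fin 3 → ℝ)} (hψ : MapsTo ψ A (level q)) :
    retract q ⁻¹' (ψ '' A) ∩ solidCone q =
      coneMap ψ '' ((fun p : ℂ × ℂ => (p.1.re, tailCoord p)) ⁻¹' (Ioc 0 1 ×ˢ A)) := by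
  ext z
  constructor
  · rintro ⟨⟨u, hu, huz⟩, hz0, hz1⟩
    have hH := ham_pos hpos hz0
    have hs := Real.sqrt_pos.2 hH
    have ht : tailCoord (⟨√(ham q z), u 0⟩, ⟨u 1, u 2⟩) = u := by
      rw [tailCoord_apply]
      ext i
      fin_cases i <;> simp
    refine ⟨(⟨√(ham q z), u 0⟩, ⟨u 1, u 2⟩), ⟨⟨hs, Real.sqrt_le_one.2 hz1⟩, ?_⟩, ?_⟩
    · change tailCoord _ ∈ A
      rwa [ht]
    · rw [coneMap, ht, huz, retract, smul_smul, mul_inv_cancel₀ hs.ne', one_smul]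
  · rintro ⟨p, ⟨hp, hu⟩, rfl⟩
    have hl := hψ hu
    have hp0 : 0 < p.1.re := hp.1
    refine ⟨⟨_, hu, ?_⟩, smul_ne_zero hp0.ne' (ne_zero_of_mem_level hl), ?_⟩
    · rw [coneMap, retract_smul q hp0, retract_of_mem hl]
    · rw [coneMap, ham_smul q hp0.ne', show ham q _ = 1 from hl, mul_one]
      exact pow_le_one₀ hp0.le hp.2

/-- The radial part of the Jacobian; its value 1/2 accounts for the factor 2 in `coneMeasure`. -/
theorem lintegral_Ioc_cube :
    ∫⁻ r in Ioc (0 : ℝ) 1, ENNReal.ofReal (2 * r ^ 3) = ENNReal.ofReal (1 / 2) := by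
  rw [← ofReal_integral_eq_lintegral_ofReal]
  · rw [← intervalIntegral.integral_of_le zero_le_one]
    congr 1
    rw [intervalIntegral.integral_const_mul, integral_pow]
    norm_num
  · exact (Continuous.integrableOn_Icc (by fun_prop)).mono_set Ioc_subset_Icc_self
  · filter_upwards [ae_restrict_mem measurableSet_Ioc] with r hr
    have := hr.1
    positivity

theorem aemeasurable_contactForm3 {α : Type*} [MeasurableSpace α] {μ : Measure α}
    {f₀ f₁ f₂ f₃ : α → ℂ × ℂ} (h₀ : AEMeasurable f₀ μ) (h₁ : AEMeasurable f₁ μ)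
    (h₂ : AEMeasurable f₂ μ) (h₃ : AEMeasurable f₃ μ) :
    AEMeasurable (fun x => contactForm3 (f₀ x) (f₁ x) (f₂ x) (f₃ x)) μ := by
  unfold contactForm3 stdLambda stdOmega
  fun_prop

theorem isAddHaarMeasure_volume_prod : (volume : Measure (ℂ × ℂ)).IsAddHaarMeasure :=
  inferInstanceAs ((volume : Measure ℂ).prod (volume : Measure ℂ)).IsAddHaarMeasure

/-- The part of the cone over $\psi(A)$ is the injective image of $(0,1]\times A$ under `coneMap`,
whose Jacobian is a function of $r$ times the chart density; change of variables and Tonelli give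
the claim. -/
theorem isContactVolume_coneMeasure {q : ℝ → ℝ} (hq : Continuous q) (hpos : ∀ t, 0 < q t) :
    IsContactVolume (level q) (coneMeasure q) := by
  refine ⟨coneMeasure_compl_level hq hpos, fun U ψ hU hψ hinj _ hmaps A hAU hA => ?_⟩
  have hc : ContinuousOn ψ A := hψ.continuousOn.mono hAU
  have himg : MeasurableSet (ψ '' A) := hA.image_of_continuousOn_injOn hc (hinj.mono hAU)
  have hmA : MapsTo ψ A (level q) := hmaps.mono_left hAU
  rw [coneMeasure_apply hq himg, retract_preimage_inter_solidCone hpos hmA]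
  set E := (fun p : ℂ × ℂ => (p.1.re, tailCoord p)) ⁻¹' (Ioc 0 1 ×ˢ A) with hE
  have hEm : MeasurableSet E := measurePreserving_coord.measurable (measurableSet_Ioc.prod hA)
  have hEinj : InjOn (coneMap ψ) E := by
    rintro p ⟨hp, hpA⟩ p' ⟨hp', hpA'⟩ h
    have hp0 : 0 < p.1.re := hp.1
    have hp0' : 0 < p'.1.re := hp'.1
    have h1 : ψ (tailCoord p) = ψ (tailCoord p') := by
      have h2 := congrArg (retract q) h
      rwa [coneMap, coneMap, retract_smul q hp0, retract_smul q hp0', retract_of_mem (hmA hpA),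
        retract_of_mem (hmA hpA')] at h2
    have h2 := hinj (hAU hpA) (hAU hpA') h1
    refine measurableEmbedding_coord.injective (Prod.ext ?_ h2)
    simp only [coneMap, h1] at h
    exact smul_left_injective ℝ (ne_zero_of_mem_level (hmA hpA')) h
  have := isAddHaarMeasure_volume_prod
  rw [← lintegral_abs_det_fderiv_eq_addHaar_image volume hEm
    (fun p hp => (hasFDerivAt_coneMap ((hψ.differentiableOn (by simp)).differentiableAt
      (hU.mem_nhds (hAU hp.2)))).hasFDerivWithinAt) hEinj]
  have h1 : ∫⁻ p in E, ENNReal.ofReal |(coneDeriv ψ p).det| =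
      ∫⁻ p in E, (fun x : ℝ × (Fin 3 → ℝ) =>
        ENNReal.ofReal (2 * x.1 ^ 3) * ENNReal.ofReal |chartDensity ψ x.2|)
          (p.1.re, tailCoord p) := by
    refine setLIntegral_congr_fun hEm fun p hp => ?_
    have hp0 : 0 < p.1.re := hp.1.1
    simp only [det_coneDeriv]
    rw [abs_mul, abs_of_nonneg (by positivity), ENNReal.ofReal_mul (by positivity)]
  have hdens : AEMeasurable (fun u => ENNReal.ofReal |chartDensity ψ u|) (volume.restrict A) := by
    have : AEMeasurable (chartDensity ψ) (volume.restrict A) :=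
      aemeasurable_contactForm3 (hc.aemeasurable hA)
        (measurable_fderiv_apply_const ℝ ψ _).aemeasurable
        (measurable_fderiv_apply_const ℝ ψ _).aemeasurable
        (measurable_fderiv_apply_const ℝ ψ _).aemeasurable
    exact (continuous_abs.measurable.comp_aemeasurable this).ennreal_ofReal
  have h2 := measurePreserving_coord.setLIntegral_comp_preimage_emb measurableEmbedding_coord
    (fun x : ℝ × (Fin 3 → ℝ) =>
        ENNReal.ofReal (2 * x.1 ^ 3) * ENNReal.ofReal |chartDensity ψ x.2|) (Ioc 0 1 ×ˢ A)
  rw [h1]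
  refine (congrArg (2 * ·) h2).trans ?_
  have h3 := lintegral_prod_mul (μ := volume.restrict (Ioc (0 : ℝ) 1))
    (f := fun r : ℝ => ENNReal.ofReal (2 * r ^ 3)) (by fun_prop) hdens
  rw [Measure.volume_eq_prod, ← Measure.prod_restrict, h3,
    lintegral_Ioc_cube, ← mul_assoc]
  have : (2 : ENNReal) * ENNReal.ofReal (1 / 2) = 1 := by
    rw [show (2 : ENNReal) = ENNReal.ofReal 2 by simp, ← ENNReal.ofReal_mul (by norm_num)]
    norm_num
  rw [this, one_mul]
  rfl

/-! ### Uniqueness of the contact volume -/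

/-- The affine slice `{Re p₁ = 1}` of `ℂ²`. -/
def affineSlice (u : Fin 3 → ℝ) : ℂ × ℂ :=
  (1 + (u 0 : ℂ) * Complex.I, (u 1 : ℂ) + (u 2 : ℂ) * Complex.I)

theorem contDiff_affineSlice : ContDiff ℝ ∞ affineSlice := by
  have h : ∀ i : Fin 3, ContDiff ℝ ∞ fun u : Fin 3 → ℝ => ((u i : ℝ) : ℂ) := fun i =>
    Complex.ofRealCLM.contDiff.comp (contDiff_apply ℝ ℝ i)
  exact (contDiff_const.add ((h 0).mul contDiff_const)).prodMk
    ((h 1).add ((h 2).mul contDiff_const))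

theorem re_affineSlice (u : Fin 3 → ℝ) : (affineSlice u).1.re = 1 := by simp [affineSlice]

theorem tailCoord_affineSlice (u : Fin 3 → ℝ) : tailCoord (affineSlice u) = u := by
  rw [tailCoord_apply]
  ext i
  fin_cases i <;> simp [affineSlice]

/-- The parametrization of an open part of `level q` by the radial projection of an affine
hyperplane. -/
def radialChart (q : ℝ → ℝ) (T : ℂ × ℂ →L[ℝ] ℂ × ℂ) (u : Fin 3 → ℝ) : ℂ × ℂ :=
  retract q (T (affineSlice u))

section RadialChart

variable {q : ℝ → ℝ} {T T' : ℂ × ℂ →L[ℝ] ℂ × ℂ}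

theorem map_affineSlice_ne_zero (hT : ∀ z, T' (T z) = z) (u : Fin 3 → ℝ) :
    T (affineSlice u) ≠ 0 := by
  intro h
  have h1 := hT (affineSlice u)
  rw [h, map_zero] at h1
  have h2 := re_affineSlice u
  rw [← h1] at h2
  simp at h2

theorem radialChart_mem (hpos : ∀ t, 0 < q t) (hT : ∀ z, T' (T z) = z) (u : Fin 3 → ℝ) :
    radialChart q T u ∈ level q :=
  retract_mem_level hpos (map_affineSlice_ne_zero hT u)

theorem contDiff_radialChart (hq : ContDiff ℝ ∞ q) (hpos : ∀ t, 0 < q t)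
    (hT : ∀ z, T' (T z) = z) : ContDiff ℝ ∞ (radialChart q T) :=
  contDiff_iff_contDiffAt.2 fun u =>
    (contDiffAt_retract hq hpos (map_affineSlice_ne_zero hT u)).comp u
      (T.contDiff.comp contDiff_affineSlice).contDiffAt

/-- The inverse of `radialChart`. -/
def radialInv (T' : ℂ × ℂ →L[ℝ] ℂ × ℂ) (z : ℂ × ℂ) : Fin 3 → ℝ :=
  ((T' z).1.re)⁻¹ • tailCoord (T' z)

theorem pos_radialChart (hpos : ∀ t, 0 < q t) (hT : ∀ z, T' (T z) = z) (u : Fin 3 → ℝ) :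
    0 < (T' (radialChart q T u)).1.re := by
  rw [radialChart, retract, map_smul, hT]
  have := Real.sqrt_pos.2 (ham_pos hpos (map_affineSlice_ne_zero hT u))
  simp [re_affineSlice, this]

theorem radialInv_radialChart (hpos : ∀ t, 0 < q t) (hT : ∀ z, T' (T z) = z) (u : Fin 3 → ℝ) :
    radialInv T' (radialChart q T u) = u := by
  have h := Real.sqrt_pos.2 (ham_pos hpos (map_affineSlice_ne_zero hT u))
  rw [radialInv, radialChart, retract, map_smul, hT, map_smul, tailCoord_affineSlice, smul_smul]
  simp only [Prod.smul_fst, Complex.real_smul, Complex.re_ofReal_mul, re_affineSlice, mul_one]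
  rw [inv_mul_cancel₀ (inv_ne_zero h.ne'), one_smul]

/-- The left inverse `radialInv` is differentiable at the image point, so the chain rule gives a
left inverse of the derivative. -/
theorem injective_fderiv_radialChart (hq : ContDiff ℝ ∞ q) (hpos : ∀ t, 0 < q t)
    (hT : ∀ z, T' (T z) = z) (u : Fin 3 → ℝ) :
    Function.Injective (fderiv ℝ (radialChart q T) u) := by
  have h1 : HasFDerivAt (radialChart q T) (fderiv ℝ (radialChart q T) u) u :=
    ((contDiff_radialChart hq hpos hT).differentiable (by simp) u).hasFDerivAt
  have h2 : DifferentiableAt ℝ (radialInv T') (radialChart q T u) := by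
    have e1 : DifferentiableAt ℝ (fun z => (T' z).1.re) (radialChart q T u) :=
      ((Complex.reCLM.comp (ContinuousLinearMap.fst ℝ ℂ ℂ)).comp T').differentiableAt
    have e2 : DifferentiableAt ℝ (fun z => tailCoord (T' z)) (radialChart q T u) :=
      (tailCoord.comp T').differentiableAt
    exact (e1.inv (pos_radialChart hpos hT u).ne').smul e2
  have h3 := h2.hasFDerivAt.comp u h1
  have h4 : radialInv T' ∘ radialChart q T = id := funext (radialInv_radialChart hpos hT)
  rw [h4] at h3
  have h5 := h3.unique (hasFDerivAt_id u)
  intro v w hvw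
  have h6 := congrArg (fderiv ℝ (radialInv T') (radialChart q T u)) hvw
  have e := fun v => congrArg (fun L : (Fin 3 → ℝ) →L[ℝ] (Fin 3 → ℝ) => L v) h5
  simp only [ContinuousLinearMap.comp_apply, ContinuousLinearMap.id_apply] at e
  rwa [e, e] at h6

theorem radialChart_surjOn (hT' : ∀ z, T (T' z) = z) {z : ℂ × ℂ} (hz : z ∈ level q)
    (hz' : 0 < (T' z).1.re) : radialChart q T (radialInv T' z) = z := by
  have h : affineSlice (radialInv T' z) = ((T' z).1.re)⁻¹ • T' z := by
    rw [radialInv, tailCoord_apply]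
    apply Prod.ext <;> apply Complex.ext <;> simp [affineSlice, hz'.ne']
  rw [radialChart, h, map_smul, hT', retract_smul q (inv_pos.2 hz'), retract_of_mem hz]

/-- Contact volumes agree on the part of `level q` covered by a radial chart. -/
theorem IsContactVolume.apply_eq_of_subset (hq : ContDiff ℝ ∞ q) (hpos : ∀ t, 0 < q t)
    (hT : ∀ z, T' (T z) = z) (hT' : ∀ z, T (T' z) = z) {m m' : Measure (ℂ × ℂ)}
    (hm : IsContactVolume (level q) m) (hm' : IsContactVolume (level q) m') {B : Set (ℂ × ℂ)}
    (hB : MeasurableSet B) (hBs : ∀ z ∈ B, z ∈ level q ∧ 0 < (T' z).1.re) : m B = m' B := by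
  have hB' : B = radialChart q T '' (radialChart q T ⁻¹' B) := by
    refine (image_preimage_eq_of_subset fun z hz => ?_).symm
    exact ⟨_, radialChart_surjOn hT' (hBs z hz).1 (hBs z hz).2⟩
  have hs := contDiff_radialChart hq hpos hT
  have hA := hs.continuous.measurable hB
  have hinj : InjOn (radialChart q T) univ :=
    (Function.LeftInverse.injective (radialInv_radialChart hpos hT)).injOn
  have hmaps : MapsTo (radialChart q T) univ (level q) := fun u _ => radialChart_mem hpos hT u
  rw [hB', hm.2 univ _ isOpen_univ hs.contDiffOn hinj
    (fun u _ => injective_fderiv_radialChart hq hpos hT u) hmaps _ (subset_univ _) hA,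
    hm'.2 univ _ isOpen_univ hs.contDiffOn hinj
    (fun u _ => injective_fderiv_radialChart hq hpos hT u) hmaps _ (subset_univ _) hA]

end RadialChart

/-- Divide by a nonzero coordinate of $z$ and put it first: `T' z` then has first coordinate 1. -/
theorem exists_linear_chart {z : ℂ × ℂ} (hz : z ≠ 0) : ∃ T T' : ℂ × ℂ →L[ℝ] ℂ × ℂ,
    (∀ w, T' (T w) = w) ∧ (∀ w, T (T' w) = w) ∧ 0 < (T' z).1.re := by
  by_cases h : z.1 = 0
  · have h2 : z.2 ≠ 0 := fun h' => hz (Prod.ext h h')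
    refine ⟨(ContinuousLinearMap.snd ℝ ℂ ℂ).prod
        ((ContinuousLinearMap.mul ℝ ℂ z.2).comp (ContinuousLinearMap.fst ℝ ℂ ℂ)),
      ((ContinuousLinearMap.mul ℝ ℂ z.2⁻¹).comp (ContinuousLinearMap.snd ℝ ℂ ℂ)).prod
        (ContinuousLinearMap.fst ℝ ℂ ℂ), fun w => ?_, fun w => ?_, ?_⟩
    · simp [h2]
    · simp [h2]
    · simp [h2]
  · refine ⟨((ContinuousLinearMap.mul ℝ ℂ z.1).comp (ContinuousLinearMap.fst ℝ ℂ ℂ)).prod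
        (ContinuousLinearMap.snd ℝ ℂ ℂ),
      ((ContinuousLinearMap.mul ℝ ℂ z.1⁻¹).comp (ContinuousLinearMap.fst ℝ ℂ ℂ)).prod
        (ContinuousLinearMap.snd ℝ ℂ ℂ), fun w => ?_, fun w => ?_, ?_⟩
    · simp [h]
    · simp [h]
    · simp [h]

/-- Contact volumes are prescribed on each radial chart. By the Lindelöf property countably many
charts cover the hypersurface, and its complement is null. -/
theorem IsContactVolume.eq {q : ℝ → ℝ} (hq : ContDiff ℝ ∞ q) (hpos : ∀ t, 0 < q t)
    {m m' : Measure (ℂ × ℂ)} (hm : IsContactVolume (level q) m)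
    (hm' : IsContactVolume (level q) m') : m = m' := by
  choose T T' hT hT' hTz using fun z : level q => exists_linear_chart (ne_zero_of_mem_level z.2)
  obtain ⟨I, hI, hIU⟩ := TopologicalSpace.isOpen_iUnion_countable
    (fun z : level q => {w : ℂ × ℂ | 0 < (T' z w).1.re})
    (fun z => isOpen_lt continuous_const (by fun_prop))
  have := hI.to_subtype
  have hlm := measurableSet_level hq.continuous
  set V : I → Set (ℂ × ℂ) := fun z => level q ∩ {w : ℂ × ℂ | 0 < (T' z w).1.re} with hV
  have hcover : level q ⊆ ⋃ z : I, V z := fun w hw => by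
    have : w ∈ ⋃ z : level q, {w : ℂ × ℂ | 0 < (T' z w).1.re} :=
      mem_iUnion.2 ⟨⟨w, hw⟩, hTz ⟨w, hw⟩⟩
    rw [← hIU] at this
    obtain ⟨z, hz, hzw⟩ := mem_iUnion₂.1 this
    exact mem_iUnion.2 ⟨⟨z, hz⟩, hw, hzw⟩
  have hVm : ∀ z, MeasurableSet (V z) := fun z =>
    hlm.inter (isOpen_lt continuous_const (by fun_prop)).measurableSet
  have key : ∀ {ν : Measure (ℂ × ℂ)}, IsContactVolume (level q) ν →
      ν.restrict (⋃ z : I, V z) = ν := fun {ν} hν => by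
    refine Measure.restrict_eq_self_of_ae_mem ?_
    have : ∀ᵐ w ∂ν, w ∈ level q := hν.1
    filter_upwards [this] with w hw using hcover hw
  rw [← key hm, ← key hm', Measure.restrict_iUnion_congr]
  intro z
  refine Measure.ext fun B hB => ?_
  rw [Measure.restrict_apply hB, Measure.restrict_apply hB]
  exact hm.apply_eq_of_subset hq hpos (hT z) (hT' z) hm' (hB.inter (hVm z)) fun w hw => hw.2

/-! ### The push-forward of Lebesgue measure by the moment map -/

theorem volume_area_lt (b : ℝ) (hb : 0 ≤ b) :
    volume {z : ℂ | Real.pi * ‖z‖ ^ 2 < b} = ENNReal.ofReal b := by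
  have h : {z : ℂ | Real.pi * ‖z‖ ^ 2 < b} = Metric.ball 0 (√(b / Real.pi)) := by
    ext z
    rw [mem_ofPred_eq, mem_ball_zero_iff, Real.lt_sqrt (norm_nonneg z), lt_div_iff₀ Real.pi_pos,
      mul_comm]
  have hpi : (NNReal.pi : ENNReal) = ENNReal.ofReal Real.pi := by
    rw [← NNReal.coe_real_pi, ENNReal.ofReal_coe_nnreal]
  rw [h, Complex.volume_ball, ← ENNReal.ofReal_pow (Real.sqrt_nonneg _),
    Real.sq_sqrt (div_nonneg hb Real.pi_pos.le), hpi,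
    ← ENNReal.ofReal_mul (div_nonneg hb Real.pi_pos.le), div_mul_cancel₀ _ Real.pi_ne_zero]

theorem volume_area_le (b : ℝ) (hb : 0 ≤ b) :
    volume {z : ℂ | Real.pi * ‖z‖ ^ 2 ≤ b} = ENNReal.ofReal b := by
  have h : {z : ℂ | Real.pi * ‖z‖ ^ 2 ≤ b} = Metric.closedBall 0 (√(b / Real.pi)) := by
    ext z
    rw [mem_ofPred_eq, mem_closedBall_zero_iff,
      Real.le_sqrt (norm_nonneg z) (div_nonneg hb Real.pi_pos.le), le_div_iff₀ Real.pi_pos, mul_comm]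
  rw [h, Measure.addHaar_closedBall_eq_addHaar_ball, ← volume_area_lt b hb]
  congr 1
  ext z
  rw [mem_ofPred_eq, mem_ball_zero_iff, Real.lt_sqrt (norm_nonneg z), lt_div_iff₀ Real.pi_pos,
      mul_comm]

/-- The disc $\pi|z|^2<b$ has area $b$, so both measures agree on rational intervals. -/
theorem map_area_volume :
    Measure.map (fun z : ℂ => Real.pi * ‖z‖ ^ 2) volume = volume.restrict (Ici (0 : ℝ)) := by
  have hm : Measurable fun z : ℂ => Real.pi * ‖z‖ ^ 2 := by fun_prop
  refine (Real.measure_ext_Ioo_rat fun a b => ?_).symm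
  rw [Measure.map_apply hm measurableSet_Ioo, Measure.restrict_apply measurableSet_Ioo]
  rcases le_total (b : ℝ) 0 with hb | hb
  · have h1 : Ioo (a : ℝ) b ∩ Ici 0 = ∅ := by
      ext x
      simp only [mem_inter_iff, mem_Ioo, mem_Ici, mem_empty_iff_false, iff_false]
      rintro ⟨h, h'⟩
      linarith
    have h2 : (fun z : ℂ => Real.pi * ‖z‖ ^ 2) ⁻¹' Ioo (a : ℝ) b = ∅ := by
      ext z
      simp only [mem_preimage, mem_Ioo, mem_empty_iff_false, iff_false]
      rintro ⟨h, h'⟩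
      have : 0 ≤ Real.pi * ‖z‖ ^ 2 := by positivity
      linarith
    rw [h1, h2]
    simp
  rcases lt_or_ge (a : ℝ) 0 with ha | ha
  · have h1 : Ioo (a : ℝ) b ∩ Ici 0 = Ico 0 (b : ℝ) := by
      ext x
      simp only [mem_inter_iff, mem_Ioo, mem_Ici, mem_Ico]
      constructor
      · rintro ⟨⟨_, h⟩, h'⟩
        exact ⟨h', h⟩
      · rintro ⟨h, h'⟩
        exact ⟨⟨by linarith, h'⟩, h⟩
    have h2 : (fun z : ℂ => Real.pi * ‖z‖ ^ 2) ⁻¹' Ioo (a : ℝ) b =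
        {z : ℂ | Real.pi * ‖z‖ ^ 2 < b} := by
      ext z
      have : 0 ≤ Real.pi * ‖z‖ ^ 2 := by positivity
      simp only [mem_preimage, mem_Ioo, mem_ofPred_eq, and_iff_right_iff_imp]
      intro _
      linarith
    rw [h1, h2, volume_area_lt _ hb, Real.volume_Ico, sub_zero]
  · have h1 : Ioo (a : ℝ) b ∩ Ici 0 = Ioo (a : ℝ) b :=
      inter_eq_left.2 fun x hx => ha.trans hx.1.le
    have h2 : (fun z : ℂ => Real.pi * ‖z‖ ^ 2) ⁻¹' Ioo (a : ℝ) b =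
        {z : ℂ | Real.pi * ‖z‖ ^ 2 < b} \ {z : ℂ | Real.pi * ‖z‖ ^ 2 ≤ a} := by
      ext z
      simp only [mem_preimage, mem_Ioo, Set.mem_sdiff, mem_ofPred_eq, not_le]
      exact and_comm
    rw [h1, h2, Real.volume_Ioo]
    rcases le_or_gt (b : ℝ) a with hab | hab
    · have h3 : {z : ℂ | Real.pi * ‖z‖ ^ 2 < b} \ {z : ℂ | Real.pi * ‖z‖ ^ 2 ≤ a} = ∅ := by
        ext z
        simp only [Set.mem_sdiff, mem_ofPred_eq, not_le, mem_empty_iff_false, iff_false]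
        rintro ⟨h, h'⟩
        linarith
      rw [h3, measure_empty, ENNReal.ofReal_of_nonpos (by linarith)]
    · have hsub : {z : ℂ | Real.pi * ‖z‖ ^ 2 ≤ a} ⊆ {z : ℂ | Real.pi * ‖z‖ ^ 2 < b} :=
        fun z hz => lt_of_le_of_lt hz hab
      have hmeas : MeasurableSet {z : ℂ | Real.pi * ‖z‖ ^ 2 ≤ a} := hm measurableSet_Iic
      rw [measure_sdiff hsub hmeas.nullMeasurableSet (by rw [volume_area_le _ ha]; simp),
        volume_area_lt _ hb, volume_area_le _ ha, ENNReal.ofReal_sub _ ha]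

theorem map_momentMap_volume :
    Measure.map momentMap volume = volume.restrict (Ici (0 : ℝ) ×ˢ Ici (0 : ℝ)) := by
  have hm : Measurable fun z : ℂ => Real.pi * ‖z‖ ^ 2 := by fun_prop
  have h := Measure.map_prod_map (volume : Measure ℂ) (volume : Measure ℂ) hm hm
  rw [map_area_volume, Measure.prod_restrict] at h
  exact h.symm

/-! ### Integration in radial coordinates of the quadrant -/

theorem det_real_prod (L : ℝ × ℝ →ₗ[ℝ] ℝ × ℝ) :
    LinearMap.det L = (L (1, 0)).1 * (L (0, 1)).2 - (L (0, 1)).1 * (L (1, 0)).2 := by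
  rw [← LinearMap.det_toMatrix (Module.Basis.finTwoProd ℝ), Matrix.det_fin_two]
  simp [LinearMap.toMatrix_apply]

/-- The coordinates `(ρ, t) ↦ ρ q(t)⁻¹ (1 - t, t)`. -/
def radialCoord (q : ℝ → ℝ) (x : ℝ × ℝ) : ℝ × ℝ :=
  (x.1 * ((q x.2)⁻¹ * (1 - x.2)), x.1 * ((q x.2)⁻¹ * x.2))

theorem exists_hasFDerivAt_radialCoord {q : ℝ → ℝ} (hq : ContDiff ℝ ∞ q) (hpos : ∀ t, 0 < q t)
    (x : ℝ × ℝ) : ∃ D : ℝ × ℝ →L[ℝ] ℝ × ℝ, HasFDerivAt (radialCoord q) D x ∧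
      D.det = x.1 * (q x.2 ^ 2)⁻¹ := by
  have hq0 := (hpos x.2).ne'
  have hr : HasDerivAt (fun t => (q t)⁻¹) (-deriv q x.2 / q x.2 ^ 2) x.2 :=
    ((hq.differentiable (by simp) x.2).hasDerivAt).inv hq0
  have ha := hr.mul ((hasDerivAt_id x.2).const_sub 1)
  have hb := hr.mul (hasDerivAt_id x.2)
  have h1 := (hasFDerivAt_fst (𝕜 := ℝ) (p := x)).mul (ha.comp_hasFDerivAt x hasFDerivAt_snd)
  have h2 := (hasFDerivAt_fst (𝕜 := ℝ) (p := x)).mul (hb.comp_hasFDerivAt x hasFDerivAt_snd)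
  refine ⟨_, h1.prodMk h2, ?_⟩
  rw [ContinuousLinearMap.det, det_real_prod]
  simp
  field_simp
  ring

theorem radialCoord_image {q : ℝ → ℝ} (hpos : ∀ t, 0 < q t) :
    radialCoord q '' (Ioc 0 1 ×ˢ Icc 0 1) =
      {w | w ≠ 0 ∧ (w.1 + w.2) * q (w.2 / (w.1 + w.2)) ≤ 1} ∩ Ici (0 : ℝ) ×ˢ Ici (0 : ℝ) := by
  ext w
  constructor
  · rintro ⟨⟨ρ, t⟩, ⟨hρ, ht⟩, rfl⟩
    obtain ⟨hρ0, hρ1⟩ := hρ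
    obtain ⟨ht0, ht1⟩ := ht
    simp only at hρ0 hρ1 ht0 ht1
    have hq := hpos t
    have hs : (radialCoord q (ρ, t)).1 + (radialCoord q (ρ, t)).2 = ρ * (q t)⁻¹ := by
      simp only [radialCoord]
      ring
    have hpos' : 0 < ρ * (q t)⁻¹ := by positivity
    have ht' : (radialCoord q (ρ, t)).2 / (ρ * (q t)⁻¹) = t := by
      simp only [radialCoord]
      field_simp
    refine ⟨⟨fun h => ?_, ?_⟩, ?_, ?_⟩
    · rw [h] at hs
      simp only [Prod.fst_zero, Prod.snd_zero, add_zero] at hs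
      exact hpos'.ne hs
    · rw [hs, ht', mul_assoc, inv_mul_cancel₀ hq.ne', mul_one]
      exact hρ1
    · have : 0 ≤ 1 - t := by linarith
      simp only [radialCoord, mem_Ici]
      positivity
    · simp only [radialCoord, mem_Ici]
      positivity
  · rintro ⟨⟨hw0, hw1⟩, hx, hy⟩
    rw [mem_Ici] at hx hy
    have hs : 0 < w.1 + w.2 := by
      rcases hx.lt_or_eq with h | h
      · linarith
      · rcases hy.lt_or_eq with h' | h'
        · linarith
        · exact absurd (Prod.ext h.symm h'.symm) hw0
    have hq := hpos (w.2 / (w.1 + w.2))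
    refine ⟨((w.1 + w.2) * q (w.2 / (w.1 + w.2)), w.2 / (w.1 + w.2)), ⟨⟨mul_pos hs hq, hw1⟩,
      div_nonneg hy hs.le, ?_⟩, ?_⟩
    · exact div_le_one_of_le₀ (by linarith) hs.le
    · simp only [radialCoord]
      ext1
      · simp only
        rw [mul_assoc, mul_inv_cancel_left₀ hq.ne']
        field_simp
        ring
      · simp only
        rw [mul_assoc, mul_inv_cancel_left₀ hq.ne']
        field_simp

theorem radialCoord_ratio {q : ℝ → ℝ} (hpos : ∀ t, 0 < q t) {x : ℝ × ℝ} (hx : 0 < x.1) :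
    (radialCoord q x).2 / ((radialCoord q x).1 + (radialCoord q x).2) = x.2 := by
  have hq := hpos x.2
  have hs : (radialCoord q x).1 + (radialCoord q x).2 = x.1 * (q x.2)⁻¹ := by
    simp only [radialCoord]
    ring
  rw [hs]
  simp only [radialCoord]
  field_simp

theorem injOn_radialCoord {q : ℝ → ℝ} (hpos : ∀ t, 0 < q t) :
    InjOn (radialCoord q) (Ioc 0 1 ×ˢ Icc 0 1) := by
  rintro x ⟨hx, -⟩ y ⟨hy, -⟩ h
  have h2 : x.2 = y.2 := by
    rw [← radialCoord_ratio hpos hx.1, ← radialCoord_ratio hpos hy.1, h]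
  have hs : ∀ x : ℝ × ℝ, (radialCoord q x).1 + (radialCoord q x).2 = x.1 * (q x.2)⁻¹ := fun x => by
    simp only [radialCoord]
    ring
  have h1 := hs x
  rw [h, hs y, h2] at h1
  exact Prod.ext (mul_right_cancel₀ (inv_ne_zero (hpos y.2).ne') h1).symm h2

/-- The integrand $(2q+(1-2t)q')/q^2$ is the derivative of $(2t-1)/q$; the two endpoints give the
two intercepts. -/
theorem integral_freq_div {q : ℝ → ℝ} (hq : ContDiff ℝ ∞ q) (hpos : ∀ t, 0 < q t) :
    ∫ t in Icc (0 : ℝ) 1, (q t ^ 2)⁻¹ * (freqOne q t + freqTwo q t) = (q 0)⁻¹ + (q 1)⁻¹ := by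
  rw [integral_Icc_eq_integral_Ioc, ← intervalIntegral.integral_of_le zero_le_one]
  have hc : Continuous fun t => (q t ^ 2)⁻¹ * (freqOne q t + freqTwo q t) :=
    ((hq.continuous.pow 2).inv₀ fun t => (pow_pos (hpos t) 2).ne').mul
      ((continuous_freqOne hq).add (continuous_freqTwo hq))
  rw [intervalIntegral.integral_eq_sub_of_hasDerivAt (f := fun t => (2 * t - 1) * (q t)⁻¹)
    (fun t _ => ?_) (hc.intervalIntegrable _ _)]
  · norm_num
    ring
  · have hq0 := (hpos t).ne'
    have h1 : HasDerivAt (fun t => (q t)⁻¹) (-deriv q t / q t ^ 2) t :=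
      ((hq.differentiable (by simp) t).hasDerivAt).inv hq0
    have h2 : HasDerivAt (fun t : ℝ => 2 * t - 1) 2 t := by
      simpa using ((hasDerivAt_id t).const_mul 2).sub_const 1
    refine (h2.mul h1).congr_deriv ?_
    rw [freqOne, freqTwo]
    field_simp
    ring

theorem ham_eq_momentMap (q : ℝ → ℝ) (z : ℂ × ℂ) :
    ham q z = ((momentMap z).1 + (momentMap z).2) *
      q ((momentMap z).2 / ((momentMap z).1 + (momentMap z).2)) := by
  simp only [ham, momentMap, ratio, sqNorm, Complex.normSq_eq_norm_sq]
  rw [← mul_add, mul_div_mul_left _ _ Real.pi_ne_zero]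

theorem ratio_eq_momentMap (z : ℂ × ℂ) :
    ratio z = (momentMap z).2 / ((momentMap z).1 + (momentMap z).2) := by
  simp only [momentMap, ratio, sqNorm, Complex.normSq_eq_norm_sq]
  rw [← mul_add, mul_div_mul_left _ _ Real.pi_ne_zero]

theorem momentMap_eq_zero {z : ℂ × ℂ} : momentMap z = 0 ↔ z = 0 := by
  simp [momentMap, Prod.ext_iff, Real.pi_ne_zero]

theorem measurable_momentMap : Measurable momentMap := by
  unfold momentMap
  fun_prop

/-- The integrand depends on `ratio` only. After the moment map and the coordinates $(\rho,t)$ with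
Jacobian $\rho/q^2$ the integral is a product, and $\int_0^1\rho\,d\rho=1/2$. -/
theorem integral_solidCone {q : ℝ → ℝ} (hq : ContDiff ℝ ∞ q) (hpos : ∀ t, 0 < q t) :
    ∫ z in solidCone q, (freqOne q (ratio z) + freqTwo q (ratio z)) =
      ((q 0)⁻¹ + (q 1)⁻¹) / 2 := by
  set g : ℝ → ℝ := fun t => freqOne q t + freqTwo q t with hg
  have hgc : Continuous g := (continuous_freqOne hq).add (continuous_freqTwo hq)
  set W : Set (ℝ × ℝ) := {w | w ≠ 0 ∧ (w.1 + w.2) * q (w.2 / (w.1 + w.2)) ≤ 1} with hW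
  have hr : Measurable fun w : ℝ × ℝ => w.2 / (w.1 + w.2) := by fun_prop
  have hWm : MeasurableSet W := by
    refine (measurableSet_singleton (0 : ℝ × ℝ)).compl.inter ?_
    exact ((measurable_fst.add measurable_snd).mul (hq.continuous.measurable.comp hr))
      measurableSet_Iic
  have hcone : solidCone q = momentMap ⁻¹' W := by
    ext z
    simp only [solidCone, hW, mem_preimage, mem_ofPred_eq, ne_eq, momentMap_eq_zero,
      ham_eq_momentMap q z]
  have h1 : ∫ z in solidCone q, g (ratio z) =
      ∫ w in W, g (w.2 / (w.1 + w.2)) ∂(Measure.map momentMap volume) := by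
    have hgr : Measurable fun w : ℝ × ℝ => g (w.2 / (w.1 + w.2)) := hgc.measurable.comp hr
    rw [setIntegral_map hWm hgr.aestronglyMeasurable measurable_momentMap.aemeasurable, hcone]
    simp only [ratio_eq_momentMap]
  change ∫ z in solidCone q, g (ratio z) = _
  rw [h1, map_momentMap_volume, Measure.restrict_restrict hWm, ← radialCoord_image hpos]
  choose D hD hDdet using exists_hasFDerivAt_radialCoord hq hpos
  have hms : MeasurableSet (Ioc (0 : ℝ) 1 ×ˢ Icc (0 : ℝ) 1) := measurableSet_Ioc.prod measurableSet_Icc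
  rw [integral_image_eq_integral_abs_det_fderiv_smul volume hms
    (fun x _ => (hD x).hasFDerivWithinAt) (injOn_radialCoord hpos)]
  have h2 : ∫ x in Ioc (0 : ℝ) 1 ×ˢ Icc (0 : ℝ) 1, |(D x).det| •
      g ((radialCoord q x).2 / ((radialCoord q x).1 + (radialCoord q x).2)) =
      ∫ x in Ioc (0 : ℝ) 1 ×ˢ Icc (0 : ℝ) 1, x.1 * ((q x.2 ^ 2)⁻¹ * g x.2) := by
    refine setIntegral_congr_fun hms fun x hx => ?_
    have hx0 : 0 < x.1 := hx.1.1
    have := hpos x.2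
    rw [radialCoord_ratio hpos hx0, hDdet, abs_of_pos (by positivity), smul_eq_mul, mul_assoc]
  rw [h2, Measure.volume_eq_prod, setIntegral_prod_mul (fun r : ℝ => r)
    (fun t => (q t ^ 2)⁻¹ * g t), integral_freq_div hq hpos,
    ← intervalIntegral.integral_of_le zero_le_one, integral_id]
  ring

theorem volume_solidCone_lt_top {q : ℝ → ℝ} (hq : ContDiff ℝ ∞ q) (hpos : ∀ t, 0 < q t) :
    volume (solidCone q) < ⊤ := by
  obtain ⟨t₀, -, ht₀⟩ := isCompact_Icc.exists_isMinOn (nonempty_Icc.2 (zero_le_one' ℝ))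
    hq.continuous.continuousOn
  have hc := hpos t₀
  set R : ℝ := 1 / (Real.pi * q t₀) with hR
  have hsub : solidCone q ⊆ Metric.closedBall 0 (√R) := fun z hz => by
    have h1 : q t₀ ≤ q (ratio z) := ht₀ (ratio_mem_Icc z)
    have h2 : Real.pi * sqNorm z * q (ratio z) ≤ 1 := hz.2
    have h3 := sqNorm_pos hz.1
    have h4 : sqNorm z ≤ R := by
      rw [hR, le_div_iff₀ (by positivity)]
      have : Real.pi * sqNorm z * q t₀ ≤ Real.pi * sqNorm z * q (ratio z) := by gcongr
      linarith
    have hn1 := Complex.normSq_nonneg z.1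
    have hn2 := Complex.normSq_nonneg z.2
    rw [mem_closedBall_zero_iff, Prod.norm_def, max_le_iff]
    constructor <;> refine Real.le_sqrt_of_sq_le ?_ <;> rw [← Complex.normSq_eq_norm_sq] <;>
      rw [sqNorm] at h4 <;> linarith
  have := isAddHaarMeasure_volume_prod
  exact (measure_mono hsub).trans_lt measure_closedBall_lt_top

theorem integral_coneMeasure {q : ℝ → ℝ} (hq : ContDiff ℝ ∞ q) (hpos : ∀ t, 0 < q t) :
    Integrable (fun z => freqOne q (ratio z) + freqTwo q (ratio z)) (coneMeasure q) ∧
      ∫ z, (freqOne q (ratio z) + freqTwo q (ratio z)) ∂(coneMeasure q) = (q 0)⁻¹ + (q 1)⁻¹ := by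
  set g : ℝ → ℝ := fun t => freqOne q t + freqTwo q t with hg
  have hgc : Continuous g := (continuous_freqOne hq).add (continuous_freqTwo hq)
  have hgm : Measurable fun z => g (ratio z) := hgc.measurable.comp measurable_ratio
  have hret := measurable_retract hq.continuous
  constructor
  · obtain ⟨C, hC⟩ := isCompact_Icc.exists_bound_of_continuousOn
      (s := Icc (0 : ℝ) 1) hgc.continuousOn
    have : IsFiniteMeasure (coneMeasure q) := ⟨by
      rw [coneMeasure_apply hq.continuous MeasurableSet.univ]
      simp only [preimage_univ, univ_inter]
      exact ENNReal.mul_lt_top (by simp) (volume_solidCone_lt_top hq hpos)⟩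
    exact Integrable.of_bound hgm.aestronglyMeasurable C
      (Eventually.of_forall fun z => hC _ (ratio_mem_Icc z))
  · change ∫ z, g (ratio z) ∂(coneMeasure q) = _
    rw [coneMeasure, integral_smul_measure, integral_map hret.aemeasurable
      hgm.aestronglyMeasurable]
    -- The rotation function is constant on rays, so the retraction can be dropped.
    have h1 : ∫ z in solidCone q, g (ratio (retract q z)) = ∫ z in solidCone q, g (ratio z) := by
      refine setIntegral_congr_fun (measurableSet_solidCone hq.continuous) fun z hz => ?_
      rw [retract, ratio_smul (inv_ne_zero (Real.sqrt_pos.2 (ham_pos hpos hz.1)).ne')]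
    rw [h1]
    have h2 := integral_solidCone hq hpos
    change ∫ z in solidCone q, g (ratio z) = _ at h2
    rw [h2]
    simp
    ring

theorem hasRuelleInvariant_level {q : ℝ → ℝ} (hq : ContDiff ℝ ∞ q) (hpos : ∀ t, 0 < q t) :
    HasRuelleInvariant (level q) ((q 0)⁻¹ + (q 1)⁻¹) := by
  have hcone := isContactVolume_coneMeasure hq.continuous hpos
  refine ⟨_, isRotationFunction_level hq hpos, ⟨_, hcone⟩, fun m hm => ?_⟩
  rw [hm.eq hq hpos hcone]
  exact integral_coneMeasure hq hpos

/-! ### The profile curve as a radial graph -/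

theorem continuous_momentMap : Continuous momentMap := by
  unfold momentMap
  fun_prop

theorem momentMap_mem_quadrant (z : ℂ × ℂ) : momentMap z ∈ quadrant :=
  ⟨by simp only [momentMap]; positivity, by simp only [momentMap]; positivity⟩

/-- Every point of the source lies on a continuous section of the moment map. -/
theorem exists_section_momentMap (z : ℂ × ℂ) : ∃ σ : ℝ × ℝ → ℂ × ℂ, Continuous σ ∧
    σ (momentMap z) = z ∧ ∀ w ∈ quadrant, momentMap (σ w) = w := by
  have key : ∀ c : ℂ, ∃ e : ℂ, ‖e‖ = 1 ∧ c = ‖c‖ * e := fun c =>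
    ⟨Complex.exp (c.arg * Complex.I), Complex.norm_exp_ofReal_mul_I _,
      (Complex.norm_mul_exp_arg_mul_I c).symm⟩
  obtain ⟨e, he, hze⟩ := key z.1
  obtain ⟨e', he', hze'⟩ := key z.2
  refine ⟨fun w => (((√(w.1 / Real.pi) : ℝ) : ℂ) * e, ((√(w.2 / Real.pi) : ℝ) : ℂ) * e'),
    by fun_prop, ?_, fun w hw => ?_⟩
  · have h : ∀ x : ℝ, 0 ≤ x → √(Real.pi * x ^ 2 / Real.pi) = x := fun x hx => by
      rw [mul_div_cancel_left₀ _ Real.pi_ne_zero, Real.sqrt_sq hx]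
    simp only [momentMap, h _ (norm_nonneg _)]
    rw [← hze, ← hze']
  · have h : ∀ x : ℝ, 0 ≤ x → Real.pi * √(x / Real.pi) ^ 2 = x := fun x hx => by
      rw [Real.sq_sqrt (div_nonneg hx Real.pi_pos.le), mul_div_cancel₀ _ Real.pi_ne_zero]
    simp only [momentMap, norm_mul, he, he', mul_one, Complex.norm_real, Real.norm_eq_abs,
      sq_abs, h _ hw.1, h _ hw.2]

/-- Neighbourhoods of $z$ and relative neighbourhoods of $\mu(z)$ correspond: one way by continuity
of $\mu$, the other by a continuous section of $\mu$ through $z$. -/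
theorem frontier_toricDomain {Ω : Set (ℝ × ℝ)} (hΩ : IsClosed Ω) :
    frontier (toricDomain Ω) = momentMap ⁻¹' profileCurve Ω := by
  have hcl : IsClosed (toricDomain Ω) := hΩ.preimage continuous_momentMap
  ext z
  rw [hcl.frontier_eq, Set.mem_sdiff, mem_interior_iff_mem_nhds]
  have : toricDomain Ω ∈ 𝓝 z ↔ Ω ∈ 𝓝[quadrant] (momentMap z) := by
    refine ⟨fun h => ?_, fun h => ?_⟩
    · obtain ⟨σ, hσ, hz, hs⟩ := exists_section_momentMap z
      have h1 : σ ⁻¹' toricDomain Ω ∈ 𝓝 (momentMap z) :=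
        hσ.continuousAt.preimage_mem_nhds (by rwa [hz])
      filter_upwards [mem_nhdsWithin_of_mem_nhds h1, self_mem_nhdsWithin] with w hw hwq
      have := hw
      rw [mem_preimage, toricDomain, mem_preimage, hs w hwq] at this
      exact this
    · exact (tendsto_nhdsWithin_of_tendsto_nhds_of_eventually_within _
        continuous_momentMap.continuousAt (Eventually.of_forall momentMap_mem_quadrant)) h
  rw [this]
  rfl

theorem exists_contDiff_implicit {G : ℝ × ℝ → ℝ} (hG : ContDiff ℝ ∞ G) {a b : ℝ}
    (h0 : G (a, b) = 0) (hd : fderiv ℝ G (a, b) (0, 1) ≠ 0) :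
    ∃ ψ : ℝ → ℝ, ψ a = b ∧ ∀ᶠ t in 𝓝 a, ContDiffAt ℝ ∞ ψ t ∧ G (t, ψ t) = 0 := by
  have inv : ∀ p : ℝ × ℝ, fderiv ℝ G p (0, 1) ≠ 0 →
      (fderiv ℝ G p ∘L .inr ℝ ℝ ℝ).IsInvertible := fun p hp =>
    ⟨ContinuousLinearEquiv.unitsEquivAut ℝ (Units.mk0 _ hp), by ext; simp⟩
  have hn : (∞ : WithTop ℕ∞) ≠ 0 := by simp
  have hc : ∀ p, ContDiffAt ℝ ∞ G p := fun p => hG.contDiffAt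
  set ψ := (hc (a, b)).implicitFunction hn (inv _ hd) with hψ
  have ha : ψ a = b := (hc (a, b)).implicitFunction_apply_self hn (inv _ hd)
  have hsm : ContDiffAt ℝ ∞ ψ a := (hc (a, b)).contDiffAt_implicitFunction hn (inv _ hd)
  have hz : ∀ᶠ t in 𝓝 a, G (t, ψ t) = 0 :=
    ((hc (a, b)).eventually_apply_implicitFunction hn (inv _ hd)).mono fun t ht => ht.trans h0
  have hcont : ∀ᶠ t in 𝓝 a, ContinuousAt ψ t :=
    ((hsm.of_le (m := 1) (by simp)).eventually (by simp)).mono fun t ht => ht.continuousAt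
  have hder : ∀ᶠ t in 𝓝 a, fderiv ℝ G (t, ψ t) (0, 1) ≠ 0 := by
    have h1 : Continuous fun p => fderiv ℝ G p (0, 1) :=
      (hG.continuous_fderiv (by simp)).clm_apply continuous_const
    have h2 : ContinuousAt (fun t => fderiv ℝ G (t, ψ t) (0, 1)) a :=
      h1.continuousAt.comp (continuousAt_id.prodMk hsm.continuousAt)
    exact h2.eventually_ne (by rwa [ha])
  refine ⟨ψ, ha, ?_⟩
  -- Smoothness of class ∞ at one point yields, for each finite order only, a neighbourhood. The
  -- theorem is therefore applied again at each nearby point of the graph, and local uniqueness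
  -- identifies the solutions.
  filter_upwards [hz, hcont, hder, hz.eventually_nhds] with t h1 h2 h3 h4
  refine ⟨?_, h1⟩
  have h5 := (hc (t, ψ t)).contDiffAt_implicitFunction hn (inv _ h3)
  refine h5.congr_of_eventuallyEq ?_
  have h6 : Tendsto (fun x => (x, ψ x)) (𝓝 t) (𝓝 (t, ψ t)) := continuousAt_id.prodMk h2
  filter_upwards [h6.eventually
    ((hc (t, ψ t)).eventually_apply_eq_iff_implicitFunction hn (inv _ h3)), h4] with x hx hx'
  exact (hx.1 (hx'.trans h1.symm)).symm

/-- The point of the segment between the unit vectors with coordinates `1 - t` and `t`. -/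
def segPt (t : ℝ) : ℝ × ℝ := (1 - t, t)

theorem segPt_mem_quadrant {t : ℝ} (ht : t ∈ Icc (0 : ℝ) 1) : segPt t ∈ quadrant :=
  ⟨sub_nonneg.2 ht.2, ht.1⟩

theorem segPt_ne_zero (t : ℝ) : segPt t ≠ 0 := fun h => by
  have h1 : (1 : ℝ) - t = 0 := congrArg Prod.fst h
  have h2 : t = 0 := congrArg Prod.snd h
  linarith

theorem contDiff_segPt : ContDiff ℝ ∞ segPt := by
  unfold segPt
  fun_prop

theorem smul_mem_quadrant {u : ℝ × ℝ} (hu : u ∈ quadrant) {s : ℝ} (hs : 0 ≤ s) :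
    s • u ∈ quadrant :=
  ⟨mul_nonneg hs hu.1, mul_nonneg hs hu.2⟩

/-- A zero of a local defining function that is transverse to the ray lies on the profile curve. -/
theorem mem_profileCurve_of_eq_zero {Ω : Set (ℝ × ℝ)} {f : ℝ × ℝ → ℝ} {w : ℝ × ℝ}
    (hf : DifferentiableAt ℝ f w) (hw : w ∈ quadrant) (h0 : f w = 0)
    (hΩ : ∀ᶠ x in 𝓝[quadrant] w, (x ∈ Ω ↔ f x ≤ 0)) (hd : fderiv ℝ f w w ≠ 0) :
    w ∈ profileCurve Ω := by
  refine ⟨(hΩ.self_of_nhdsWithin hw).2 h0.le, fun hn => hd ?_⟩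
  have h1 : Tendsto (fun s : ℝ => s • w) (𝓝 1) (𝓝[quadrant] w) := by
    refine tendsto_nhdsWithin_of_tendsto_nhds_of_eventually_within _ ?_ ?_
    · have : ContinuousAt (fun s : ℝ => s • w) 1 := by fun_prop
      simpa [ContinuousAt] using this
    · filter_upwards [lt_mem_nhds (zero_lt_one' ℝ)] with s hs
      exact smul_mem_quadrant hw hs.le
  -- If `Ω` were a relative neighbourhood of `w`, then `f ≤ 0 = f w` along the ray near `w`, and the
  -- radial derivative would vanish.
  have h2 : IsLocalMax (fun s : ℝ => f (s • w)) 1 := by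
    filter_upwards [h1.eventually hΩ, h1.eventually hn] with s hs hs'
    simpa [h0] using hs.1 hs'
  have h3 : HasDerivAt (fun s : ℝ => s • w) w 1 := by
    simpa using (hasDerivAt_id (1 : ℝ)).smul_const w
  have h4 : HasDerivAt (fun s : ℝ => f (s • w)) (fderiv ℝ f w w) 1 :=
    HasFDerivAt.comp_hasDerivAt (l := f) 1 (by simpa using hf.hasFDerivAt) h3
  exact h2.hasDerivAt_eq_zero h4

theorem zero_notMem_profileCurve {Ω : Set (ℝ × ℝ)} (hΩ : IsSmoothStarShaped Ω) :
    (0 : ℝ × ℝ) ∉ profileCurve Ω := fun h => h.2 hΩ.nhds_origin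

/-- The radius of the profile curve is locally the restriction of a smooth function. -/
theorem exists_local_radius {Ω : Set (ℝ × ℝ)} (hΩ : IsSmoothStarShaped Ω) {a b : ℝ}
    (hb : 0 < b) (hp : b • segPt a ∈ profileCurve Ω) :
    ∃ ψ : ℝ → ℝ, ∀ᶠ t in 𝓝 a, ContDiffAt ℝ ∞ ψ t ∧ 0 < ψ t ∧
      (t ∈ Icc (0 : ℝ) 1 → ψ t • segPt t ∈ profileCurve Ω) := by
  obtain ⟨f, hf, hf0, hfΩ, hfd⟩ := hΩ.smooth_transverse _ hp
  have hmap : ContDiff ℝ ∞ fun x : ℝ × ℝ => x.2 • segPt x.1 :=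
    contDiff_snd.smul (contDiff_segPt.comp contDiff_fst)
  have hG : ContDiff ℝ ∞ fun x : ℝ × ℝ => f (x.2 • segPt x.1) := hf.comp hmap
  have hline : HasDerivAt (fun s : ℝ => f (s • segPt a)) (fderiv ℝ f (b • segPt a) (segPt a)) b := by
    have h3 : HasDerivAt (fun s : ℝ => s • segPt a) (segPt a) b := by
      simpa using (hasDerivAt_id b).smul_const (segPt a)
    exact HasFDerivAt.comp_hasDerivAt (l := f) b (hf.differentiable (by simp) _).hasFDerivAt h3
  -- The partial derivative in the radius, times `b`, is the radial derivative of `f`, nonzero by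
  -- transversality.
  have hd : fderiv ℝ (fun x : ℝ × ℝ => f (x.2 • segPt x.1)) (a, b) (0, 1) ≠ 0 := by
    have h1 : HasDerivAt (fun s : ℝ => ((a, s) : ℝ × ℝ)) (0, 1) b :=
      (hasDerivAt_const b a).prodMk (hasDerivAt_id b)
    have h2 := HasFDerivAt.comp_hasDerivAt (l := fun x : ℝ × ℝ => f (x.2 • segPt x.1)) b
      (hG.differentiable (by simp) (a, b)).hasFDerivAt h1
    rw [h2.unique hline]
    intro h
    refine hfd ?_
    rw [map_smul, h, smul_zero]
  obtain ⟨ψ, hψa, hψ⟩ := exists_contDiff_implicit hG (a := a) (b := b) hf0 hd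
  have hψc : ContinuousAt ψ a := hψ.self_of_nhds.1.continuousAt
  have hpt : ContinuousAt (fun t => ψ t • segPt t) a :=
    hψc.smul contDiff_segPt.continuous.continuousAt
  have hpt' : Tendsto (fun t => ψ t • segPt t) (𝓝 a) (𝓝 (b • segPt a)) := by
    have := hpt.tendsto
    rwa [hψa] at this
  have hpos : ∀ᶠ t in 𝓝 a, 0 < ψ t := hψc.eventually_const_lt (by rwa [hψa])
  have hder : ∀ᶠ w in 𝓝 (b • segPt a), fderiv ℝ f w w ≠ 0 := by
    have : Continuous fun w => fderiv ℝ f w w :=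
      (hf.continuous_fderiv (by simp)).clm_apply continuous_id
    exact this.continuousAt.eventually_ne hfd
  have hq : ∀ᶠ w in 𝓝 (b • segPt a), w ∈ quadrant →
      ∀ᶠ x in 𝓝[quadrant] w, (x ∈ Ω ↔ f x ≤ 0) :=
    eventually_nhdsWithin_iff.1 (eventually_eventually_nhdsWithin.2 hfΩ)
  refine ⟨ψ, ?_⟩
  filter_upwards [hψ, hpos, hpt'.eventually hder, hpt'.eventually hq] with t h1 h2 h3 h4
  refine ⟨h1.1, h2, fun ht => ?_⟩
  have hw := smul_mem_quadrant (segPt_mem_quadrant ht) h2.le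
  exact mem_profileCurve_of_eq_zero (hf.differentiable (by simp) _) hw h1.2 (h4 hw) h3

/-- The radius of the profile curve extends to a smooth positive function on the line. -/
theorem exists_radius {Ω : Set (ℝ × ℝ)} (hΩ : IsSmoothStarShaped Ω) :
    ∃ R : ℝ → ℝ, ContDiff ℝ ∞ R ∧ (∀ t, 0 < R t) ∧
      ∀ t ∈ Icc (0 : ℝ) 1, ∀ s, 0 < s → (s • segPt t ∈ profileCurve Ω ↔ s = R t) := by
  have hex : ∀ t ∈ Icc (0 : ℝ) 1, ∃! s : ℝ, 0 < s ∧ s • segPt t ∈ profileCurve Ω := fun t ht =>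
    hΩ.meets_ray_once _ (segPt_mem_quadrant ht) (segPt_ne_zero t)
  -- Admissible radii: a single point over `[0,1]`, every positive number elsewhere. These sets are
  -- convex, so the local smooth solutions glue by a partition of unity, with forced values on
  -- `[0,1]`.
  let S : ℝ → Set ℝ := fun t => {s | 0 < s ∧ (t ∈ Icc (0 : ℝ) 1 → s • segPt t ∈ profileCurve Ω)}
  have hconv : ∀ t, Convex ℝ (S t) := fun t => by
    by_cases ht : t ∈ Icc (0 : ℝ) 1
    · refine Set.Subsingleton.convex fun x hx y hy => ?_
      exact (hex t ht).unique ⟨hx.1, hx.2 ht⟩ ⟨hy.1, hy.2 ht⟩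
    · have : S t = Ioi 0 := by
        ext s
        exact ⟨fun h => h.1, fun h => ⟨h, fun h' => absurd h' ht⟩⟩
      rw [this]
      exact convex_Ioi 0
  obtain ⟨R, hR⟩ := exists_contMDiffMap_forall_mem_convex_of_local (n := (⊤ : ℕ∞))
    (modelWithCornersSelf ℝ ℝ) hconv fun x => by
      by_cases hx : x ∈ Icc (0 : ℝ) 1
      · obtain ⟨b, ⟨hb, hp⟩, -⟩ := hex x hx
        obtain ⟨ψ, hψ⟩ := exists_local_radius hΩ hb hp
        refine ⟨_, hψ, ψ, ?_, fun y hy => ⟨hy.2.1, hy.2.2⟩⟩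
        exact contMDiffOn_iff_contDiffOn.2 fun y hy => hy.1.contDiffWithinAt
      · refine ⟨_, isClosed_Icc.isOpen_compl.mem_nhds hx, fun _ => 1, contMDiffOn_const,
          fun y hy => ⟨one_pos, fun h => absurd h hy⟩⟩
  refine ⟨R, R.contMDiff.contDiff, fun t => (hR t).1, fun t ht s hs => ⟨fun h => ?_, ?_⟩⟩
  · exact (hex t ht).unique ⟨hs, h⟩ ⟨(hR t).1, (hR t).2 ht⟩
  · rintro rfl
    exact (hR t).2 ht

theorem momentMap_eq_smul_segPt {z : ℂ × ℂ} (hz : z ≠ 0) :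
    momentMap z = (Real.pi * sqNorm z) • segPt (ratio z) := by
  refine Prod.ext ?_ ?_
  · simp only [momentMap, segPt, Prod.smul_mk, smul_eq_mul, ← Complex.normSq_eq_norm_sq]
    rw [normSq_fst_eq hz]
    ring
  · simp only [momentMap, segPt, Prod.smul_mk, smul_eq_mul, ← Complex.normSq_eq_norm_sq]
    rw [normSq_snd_eq hz]
    ring

/-- The last point of `Ω` on a ray is the point of the profile curve. -/
theorem sSup_ray_eq {Ω : Set (ℝ × ℝ)} (hΩ : IsSmoothStarShaped Ω) {u : ℝ × ℝ} (hu : u ∈ quadrant)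
    (hu0 : u ≠ 0) {r : ℝ} (hr : ∀ s, 0 < s → s • u ∈ profileCurve Ω → s = r) :
    sSup {s : ℝ | s • u ∈ Ω} = r := by
  have hcont : Continuous fun s : ℝ => s • u := by fun_prop
  have hcl : IsClosed {s : ℝ | s • u ∈ Ω} := hΩ.isCompact.isClosed.preimage hcont
  have hbdd : BddAbove {s : ℝ | s • u ∈ Ω} := by
    obtain ⟨C, hC⟩ := hΩ.isCompact.isBounded.exists_norm_le
    refine ⟨C / ‖u‖, fun s hs => ?_⟩
    rw [le_div_iff₀ (norm_pos_iff.2 hu0)]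
    refine le_trans ?_ (hC _ hs)
    rw [norm_smul]
    exact mul_le_mul_of_nonneg_right (le_abs_self s) (norm_nonneg u)
  have hto : ∀ s₀ : ℝ, 0 ≤ s₀ →
      Tendsto (fun s : ℝ => s • u) (𝓝[>] s₀) (𝓝[quadrant] (s₀ • u)) := fun s₀ h₀ => by
    refine tendsto_nhdsWithin_of_tendsto_nhds_of_eventually_within _
      (hcont.continuousAt.mono_left nhdsWithin_le_nhds) ?_
    filter_upwards [self_mem_nhdsWithin] with s hs
    exact smul_mem_quadrant hu (h₀.trans (le_of_lt hs))
  obtain ⟨s₁, hs₁, hs₁'⟩ : ∃ s : ℝ, s • u ∈ Ω ∧ 0 < s := by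
    have h0 : Ω ∈ 𝓝[quadrant] ((0 : ℝ) • u) := by
      rw [zero_smul]
      exact hΩ.nhds_origin
    exact (((hto 0 le_rfl).eventually h0).and self_mem_nhdsWithin).exists
  have hmem := hcl.csSup_mem ⟨s₁, hs₁⟩ hbdd
  have hpos : 0 < sSup {s : ℝ | s • u ∈ Ω} := hs₁'.trans_le (le_csSup hbdd hs₁)
  -- Were `Ω` a relative neighbourhood of the last point, the ray would stay in `Ω` beyond the
  -- supremum.
  refine hr _ hpos ⟨hmem, fun hn => ?_⟩
  obtain ⟨s, hs, hs'⟩ := (((hto _ hpos.le).eventually hn).and self_mem_nhdsWithin).exists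
  exact absurd (le_csSup hbdd hs) (not_le.2 hs')

/-- Take $q=1/R$. Since $\mu(z)=\pi|z|^2\,(1-t,t)$ with $t$ the `ratio` of $z$, lying over the
profile curve means $\pi|z|^2=R(t)$, that is `ham q z = 1`. The intercepts are $R(0)$ and $R(1)$. -/
theorem exists_level_eq {Ω : Set (ℝ × ℝ)} (hΩ : IsSmoothStarShaped Ω) :
    ∃ q : ℝ → ℝ, ContDiff ℝ ∞ q ∧ (∀ t, 0 < q t) ∧ frontier (toricDomain Ω) = level q ∧
      interceptOne Ω = (q 0)⁻¹ ∧ interceptTwo Ω = (q 1)⁻¹ := by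
  obtain ⟨R, hR, hpos, hiff⟩ := exists_radius hΩ
  refine ⟨fun t => (R t)⁻¹, hR.inv fun t => (hpos t).ne', fun t => inv_pos.2 (hpos t), ?_, ?_, ?_⟩
  · rw [frontier_toricDomain hΩ.isCompact.isClosed]
    ext z
    rw [mem_preimage]
    by_cases hz : z = 0
    · subst hz
      refine iff_of_false ?_ fun h => ne_zero_of_mem_level h rfl
      rw [momentMap_eq_zero.2 rfl]
      exact zero_notMem_profileCurve hΩ
    · rw [momentMap_eq_smul_segPt hz, hiff _ (ratio_mem_Icc z) _ (mul_pos Real.pi_pos (sqNorm_pos hz)),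
        level, mem_ofPred_eq, ham, mul_inv_eq_one₀ (hpos _).ne']
  · have h := sSup_ray_eq hΩ (segPt_mem_quadrant (left_mem_Icc.2 zero_le_one)) (segPt_ne_zero 0)
      fun s hs h => (hiff 0 (left_mem_Icc.2 zero_le_one) s hs).1 h
    simpa [segPt, interceptOne] using h
  · have h := sSup_ray_eq hΩ (segPt_mem_quadrant (right_mem_Icc.2 zero_le_one)) (segPt_ne_zero 1)
      fun s hs h => (hiff 1 (right_mem_Icc.2 zero_le_one) s hs).1 h
    simpa [segPt, interceptTwo] using h

end ToricRuelle

end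

theorem proposition2p2 (Ω : Set (ℝ × ℝ)) (hΩ : ToricRuelle.IsSmoothStarShaped Ω) :
    ToricRuelle.HasRuelleInvariant (frontier (ToricRuelle.toricDomain Ω))
      (ToricRuelle.interceptOne Ω + ToricRuelle.interceptTwo Ω) := by
  obtain ⟨q, hq, hpos, hY, h1, h2⟩ := ToricRuelle.exists_level_eq hΩ
  rw [hY, h1, h2]
  exact ToricRuelle.hasRuelleInvariant_level hq hpos
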